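/- Let $a,\sigma>0$ and let $\nu$ be a L\'evy measure concentrated on $(0,\infty)$ with $\int_{(0,\infty)}(\xi\wedge 1)\,\nu(d\xi)<\infty$. For $s\ge 0$ and $u\in\mathbb{C}$ with $\operatorname{Re}u\le 0$ put \[ \psi(s,u)=\frac{u e^{-as}}{1-\frac{\sigma^2}{2a}u(1-e^{-as})},\qquad \mathrm{II}(t,u)=\exp\Big(\int_0^t\int_{(0,\infty)}\big(e^{\xi\psi(s,u)}-1\big)\,\nu(d\xi)\,ds\Big). \] Let $\mu_{\alpha,\beta}$ ($\alpha,\beta>0$) denote the Bessel distribution \[ \mu_{\alpha,\beta}(dx)=e^{-\alpha}\delta_0(dx)+\beta e^{-\alpha-\beta x}\sqrt{\tfrac{\alpha}{\beta x}}\,I_1\big(2\sqrt{\alpha\beta x}\big)\,dx\quad\text{on }[0,\infty), \] where $I_1(r)=\frac r2\sum_{k\ge0}\frac{(r^2/4)^k}{k!\,(k+1)!}$, and put $\alpha(s,\xi)=\frac{2a\xi}{\sigma^2(e^{as}-1)}$, $\beta(s)=\frac{2ae^{as}}{\sigma^2(e^{as}-1)}$. Suppose that $\int_{(0,1)}\xi\ln(1/\xi)\,\nu(d\xi)<\infty$.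 Then: (1) For every $t>0$ the function $u\mapsto \mathrm{II}(t,u)$, $\operatorname{Re}u\le0$, is the characteristic function of a compound Poisson distribution: the number \[ \lambda=\int_0^t\int_{(0,\infty)}\big(1-e^{-\alpha(s,\xi)}\big)\,\nu(d\xi)\,ds \] is finite, it is positive if $\nu\neq0$, and there is a probability measure $\rho$ on $(0,\infty)$ that is the mixture of the restrictions of Bessel distributions to $(0,\infty)$ in the sense that \[ \lambda\,\rho(B)=\int_0^t\int_{(0,\infty)}\mu_{\alpha(s,\xi),\beta(s)}\big(B\cap(0,\infty)\big)\,\nu(d\xi)\,ds\quad\text{for all Borel sets }B, \] such that $\int e^{ux}\,\eta(dx)=\mathrm{II}(t,u)$ whenever $\operatorname{Re}u\le 0$, where $\eta=e^{-\lambda}\sum_{n\ge0}\frac{\lambda^n}{n!}\rho^{*n}$ is the compound Poisson distribution with intensity $\lambda$ and jump distribution $\rho$ (for $\nu=0$ this is the degenerate case $\lambda=0$, $\eta=\delta_0$). (2) Let $(Z_t)_{t\ge0}$ be the jump-diffusion CIR process with $\theta=0$ started from $0$, that is, an adapted c\`adl\`ag $[0,\infty)$-valued solution of \[ dZ_t=-aZ_t\,dt+\sigma\sqrt{Z_t}\,dW_t+dJ_t,\qquad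 Z_0=0, \] where $W$ is a Brownian motion and $J$ an independent pure-jump L\'evy process with L\'evy measure $\nu$. Here it suffices that $Z$ solves the equation in the weak sense of the martingale problem: for every smooth compactly supported $f:\mathbb{R}\to\mathbb{R}$ the process $f(Z_t)-\int_0^t\mathcal{A}f(Z_s)\,ds$ is a martingale, where \[ \mathcal{A}f(x)=-a x f'(x)+\tfrac{\sigma^2x}{2}f''(x)+\int_{(0,\infty)}\big(f(x+\xi)-f(x)\big)\,\nu(d\xi). \] Then $P(Z_t=0)>0$ for all $t>0$. -/

import Mathlib

open MeasureTheory ProbabilityTheory Filter Set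
open scoped NNReal ENNReal Topology

noncomputable section

/-- `ν` is a Lévy measure concentrated on `(0, ∞)` with `∫ (ξ ∧ 1) ν(dξ) < ∞`, i.e. the Lévy measure
of a driftless pure-jump Lévy process with positive jumps of finite variation. -/
structure IsPositiveJumpLevyMeasure (ν : Measure ℝ) : Prop where
  concentrated : ν (Iic 0) = 0
  finite_min : ∫⁻ ξ in Ioi (0 : ℝ), ENNReal.ofReal (min ξ 1) ∂ν < ∞

/-- The generator of the jump-diffusion CIR equation
`dX = a (θ - X) dt + σ √X dW + dJ`, where `J` is the pure-jump Lévy process with Lévy measure `ν`: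
`A f (x) = a (θ - x) f'(x) + (σ² x / 2) f''(x) + ∫_{(0,∞)} (f (x + ξ) - f x) ν(dξ)`. -/
def jcirGenerator (a θ σ : ℝ) (ν : Measure ℝ) (f : ℝ → ℝ) (x : ℝ) : ℝ :=
  a * (θ - x) * deriv f x + σ ^ 2 * x / 2 * deriv (deriv f) x
    + ∫ ξ in Ioi (0 : ℝ), (f (x + ξ) - f x) ∂ν

/-- Right-continuous with left limits. -/
def IsCadlagPath (z : ℝ≥0 → ℝ) : Prop :=
  ∀ t, ContinuousWithinAt z (Ici t) t ∧ ∃ l, Tendsto z (𝓝[<] t) (𝓝 l)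

/-- `X` is a jump-diffusion CIR process started from `x`: an adapted càdlàg process with values in
`[0, ∞)` and `X 0 = x` which solves `dX = a (θ - X) dt + σ √X dW + dJ` in the weak sense, expressed
by the martingale problem: for every smooth compactly supported `f` the process
`f (X t) - ∫₀ᵗ A f (X s) ds` is a martingale. By Itô's formula every solution of the stochastic
differential equation on a filtered probability space has this property. -/
structure IsJCIRProcess {Ω : Type*} [mΩ : MeasurableSpace Ω] (a θ σ : ℝ) (ν : Measure ℝ) (x : ℝ)
    (𝓕 : Filtration ℝ≥0 mΩ) (P : Measure Ω) (X : ℝ≥0 → Ω → ℝ) : Prop where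
  adapted : ∀ t, Measurable[𝓕 t] (X t)
  start : ∀ᵐ ω ∂P, X 0 ω = x
  nonneg : ∀ᵐ ω ∂P, ∀ t, 0 ≤ X t ω
  cadlag : ∀ᵐ ω ∂P, IsCadlagPath (fun t => X t ω)
  martingale : ∀ f : ℝ → ℝ, ContDiff ℝ ((⊤ : ℕ∞) : WithTop ℕ∞) f → HasCompactSupport f →
    Martingale (fun (t : ℝ≥0) ω =>
      f (X t ω) - ∫ s in (0 : ℝ)..t, jcirGenerator a θ σ ν f (X s.toNNReal ω)) 𝓕 P

/-- `ψ(t, u) = u e^{-at} / (1 - (σ² / 2a) u (1 - e^{-at}))`. -/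
def jcirPsi (a σ t : ℝ) (u : ℂ) : ℂ :=
  u * (Real.exp (-a * t) : ℂ)
    / (1 - ((σ ^ 2 / (2 * a) : ℝ) : ℂ) * u * (1 - (Real.exp (-a * t) : ℂ)))

/-- The factor `II = exp (∫₀ᵗ ∫_{(0,∞)} (e^{ξ ψ(s,u)} - 1) ν(dξ) ds)`. -/
def jcirFactorII (a σ : ℝ) (ν : Measure ℝ) (t : ℝ) (u : ℂ) : ℂ :=
  Complex.exp (∫ s in (0 : ℝ)..t, ∫ ξ in Ioi (0 : ℝ),
    (Complex.exp ((ξ : ℂ) * jcirPsi a σ s u) - 1) ∂ν)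

/-- The modified Bessel function of the first kind of order `1`. -/
def besselIOne (r : ℝ) : ℝ :=
  r / 2 * ∑' k : ℕ, (r ^ 2 / 4) ^ k / ((k.factorial : ℝ) * ((k + 1).factorial : ℝ))

/-- The Bessel distribution with parameters `α, β > 0`:
`e^{-α} δ₀(dx) + β e^{-α-βx} √(α/(βx)) I₁(2 √(αβx)) dx` on `[0, ∞)`. -/
def besselDistribution (α β : ℝ) : Measure ℝ :=
  ENNReal.ofReal (Real.exp (-α)) • Measure.dirac 0
    + (volume.restrict (Ioi (0 : ℝ))).withDensity (fun x => ENNReal.ofReal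
        (β * Real.exp (-α - β * x) * √(α / (β * x)) * besselIOne (2 * √(α * β * x))))

/-- `α(s, ξ) = 2 a ξ / (σ² (e^{as} - 1))`. -/
def jcirAlpha (a σ s ξ : ℝ) : ℝ := 2 * a * ξ / (σ ^ 2 * (Real.exp (a * s) - 1))

/-- `β(s) = 2 a e^{as} / (σ² (e^{as} - 1))`. -/
def jcirBeta (a σ s : ℝ) : ℝ :=
  2 * a * Real.exp (a * s) / (σ ^ 2 * (Real.exp (a * s) - 1))

/-- The `n`-fold convolution power of a measure on `ℝ`. -/
def convPower (ρ : Measure ℝ) : ℕ → Measure ℝ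
  | 0 => Measure.dirac 0
  | n + 1 => Measure.conv (convPower ρ n) ρ

/-- The compound Poisson distribution with intensity `r` and jump distribution `ρ`:
`e^{-r} ∑ₙ (rⁿ / n!) ρ^{∗n}`. -/
def compoundPoisson (r : ℝ≥0) (ρ : Measure ℝ) : Measure ℝ :=
  Measure.sum fun n : ℕ =>
    ENNReal.ofReal (Real.exp (-(r : ℝ)) * (r : ℝ) ^ n / (n.factorial : ℝ)) • convPower ρ n

end

/-!
Compound Poisson part. The Bessel distribution with parameters `α`, `β` is the law of the sum of a
Poisson(`α`) number of independent exponential variables of rate `β`; expanding its density in a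
power series and integrating term by term gives the transform `exp (α u / (β - u))`, and for `α =
α(s, ξ)`, `β = β(s)` the exponent is exactly `ξ ψ(s, u)` (`integral_cexp_mul_besselDensity`,
`jcirAlpha_mul_div_jcirBeta_sub`). Since `1 - e^{-α(s, ξ)} ≤ min 1 (2 ξ / (σ² s))`, its time
integral over `(0, t]` is `O(ξ log (1 / ξ))` for small `ξ` and bounded for large `ξ`, so the
logarithmic moment condition makes the total intensity finite (`lintegral_jump_intensity_lt_top`).
The mixture of the Bessel distributions restricted to `(0, ∞)` is then a finite measure
(`jcirJumpMeasure`), and Fubini turns the integral of `e^{ux} - 1` against it into the exponent of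
`II(t, u)`; normalizing the mixture gives the jump distribution.

Atom at zero. The expectation of the martingale problem, extended from compactly supported functions
to `x ↦ e^{-qx}` by smooth cutoffs (`IsJCIRProcess.integral_exp_neg_mul`), is a first-order linear
equation for `E e^{-q Z_s}` as a function of `(s, q)`. Along a characteristic `q' = a q + σ² q² / 2`
the derivative in `q` drops out and a scalar linear equation with right derivatives remains, for
which right-continuity of the paths is enough; hence `E e^{-l Z_t} = exp (-∫₀ᵗ ∫ (1 - e^{-ξ p(s)})
ν(dξ) ds)` with `p(s) = -ψ(s, -l)` (`IsJCIRProcess.laplace_eq_of_characteristic`). As `ξ p(s) ≤ α(s,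
ξ)`, this is at least `e^{-λ}` for every `l`, where `λ` is the total intensity, and `l → ∞` yields
`P(Z_t = 0) ≥ e^{-λ} > 0`.
-/

/-! ### The Bessel distribution -/

/-- The density on `(0, ∞)` of the absolutely continuous part of `besselDistribution α β`. -/
noncomputable def besselDensity (α β x : ℝ) : ℝ :=
  β * Real.exp (-α - β * x) * √(α / (β * x)) * besselIOne (2 * √(α * β * x))

lemma measurable_besselIOne : Measurable besselIOne := by
  unfold besselIOne
  refine (by fun_prop : Measurable fun r : ℝ => r / 2).mul (Measurable.tsum fun k => ?_)
  fun_prop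

/-- For `α, β, x > 0` the square roots in the Bessel density cancel and leave a power series
in `x`. -/
lemma besselDensity_eq_tsum {α β x : ℝ} (hα : 0 < α) (hβ : 0 < β) (hx : 0 < x) :
    besselDensity α β x = ∑' k : ℕ, Real.exp (-α) * ((α * β) ^ (k + 1) /
      ((k.factorial : ℝ) * ((k + 1).factorial : ℝ))) * (x ^ k * Real.exp (-(β * x))) := by
  have hs : √(α / (β * x)) * √(α * β * x) = α := by
    rw [← Real.sqrt_mul (by positivity)]
    rw [show α / (β * x) * (α * β * x) = α ^ 2 by field_simp]
    exact Real.sqrt_sq hα.le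
  have hq : (2 * √(α * β * x)) ^ 2 / 4 = α * β * x := by
    rw [mul_pow, Real.sq_sqrt (by positivity)]; ring
  rw [besselDensity, besselIOne, hq]
  rw [show β * Real.exp (-α - β * x) * √(α / (β * x)) * (2 * √(α * β * x) / 2 *
      ∑' k : ℕ, (α * β * x) ^ k / ((k.factorial : ℝ) * ((k + 1).factorial : ℝ)))
      = (β * Real.exp (-α - β * x) * (√(α / (β * x)) * √(α * β * x))) *
      ∑' k : ℕ, (α * β * x) ^ k / ((k.factorial : ℝ) * ((k + 1).factorial : ℝ)) by ring,
    hs, ← tsum_mul_left]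
  refine tsum_congr fun k => ?_
  rw [sub_eq_add_neg, Real.exp_add, mul_pow (α * β) x k, pow_succ (α * β) k]
  ring

lemma besselDensity_nonneg {α β x : ℝ} (hα : 0 < α) (hβ : 0 < β) (hx : 0 < x) :
    0 ≤ besselDensity α β x := by
  rw [besselDensity_eq_tsum hα hβ hx]
  exact tsum_nonneg fun k => by positivity

lemma norm_pow_mul_cexp {r : ℂ} (k : ℕ) {x : ℝ} (hx : 0 < x) :
    ‖(x : ℂ) ^ k * Complex.exp (-(r * x))‖ = x ^ k * Real.exp (-(r.re * x)) := by
  simp [Complex.norm_exp, abs_of_pos hx]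

lemma integral_pow_mul_exp_Ioi {r : ℝ} (hr : 0 < r) (k : ℕ) :
    ∫ x in Ioi (0 : ℝ), x ^ k * Real.exp (-(r * x)) = k.factorial / r ^ (k + 1) := by
  have h := Real.integral_rpow_mul_exp_neg_mul_Ioi (a := (k : ℝ) + 1) (r := r) (by positivity) hr
  rw [Real.Gamma_nat_eq_factorial, show ((k : ℝ) + 1) = ((k + 1 : ℕ) : ℝ) by push_cast; rfl,
    Real.rpow_natCast, one_div, inv_pow, inv_mul_eq_div] at h
  rw [← h]
  simp

lemma integral_norm_pow_mul_cexp_Ioi {r : ℂ} (hr : 0 < r.re) (k : ℕ) :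
    ∫ x in Ioi (0 : ℝ), ‖(x : ℂ) ^ k * Complex.exp (-(r * x))‖
      = k.factorial / r.re ^ (k + 1) := by
  rw [← integral_pow_mul_exp_Ioi hr k]
  exact setIntegral_congr_fun measurableSet_Ioi fun x hx => norm_pow_mul_cexp k hx

lemma integrableOn_pow_mul_cexp_Ioi {r : ℂ} (hr : 0 < r.re) (k : ℕ) :
    IntegrableOn (fun x : ℝ => (x : ℂ) ^ k * Complex.exp (-(r * x))) (Ioi 0) := by
  -- A nonzero Bochner integral of the norm certifies integrability.
  refine (integrable_norm_iff (by fun_prop)).1 (Integrable.of_integral_ne_zero ?_)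
  rw [integral_norm_pow_mul_cexp_Ioi hr]
  have := k.factorial_pos
  positivity

lemma integral_pow_mul_cexp_Ioi {r : ℂ} (hr : 0 < r.re) (k : ℕ) :
    ∫ x in Ioi (0 : ℝ), (x : ℂ) ^ k * Complex.exp (-(r * x)) = k.factorial / r ^ (k + 1) := by
  have hr0 : r ≠ 0 := by rintro rfl; simp at hr
  induction k with
  | zero =>
    have h := integral_exp_mul_complex_Ioi (a := -r) (by simpa using hr) 0
    simp only [neg_mul, Complex.ofReal_zero, mul_zero, Complex.exp_zero] at h
    simp [h]
  | succ k ih =>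
    have hd : ∀ x : ℝ, HasDerivAt (fun x : ℝ => (x : ℂ) ^ (k + 1) * Complex.exp (-(r * x)))
        (((k + 1 : ℕ) : ℂ) * ((x : ℂ) ^ k * Complex.exp (-(r * x)))
          - r * ((x : ℂ) ^ (k + 1) * Complex.exp (-(r * x)))) x := fun x => by
      have h1 : HasDerivAt (fun z : ℂ => z ^ (k + 1) * Complex.exp (-(r * z)))
          (((k + 1 : ℕ) : ℂ) * (x : ℂ) ^ k * Complex.exp (-(r * x))
            + (x : ℂ) ^ (k + 1) * (Complex.exp (-(r * x)) * (-(r * 1)))) (x : ℂ) := by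
        refine ((hasDerivAt_pow (k + 1) (x : ℂ)).fun_mul
          ((((hasDerivAt_id' (x : ℂ)).const_mul r).fun_neg).cexp)).congr_deriv ?_
        simp
      convert! h1.comp_ofReal using 1
      ring
    have hi := ((integrableOn_pow_mul_cexp_Ioi hr k).const_mul ((k + 1 : ℕ) : ℂ))
    have hi' := ((integrableOn_pow_mul_cexp_Ioi hr (k + 1)).const_mul r)
    have hlim : Tendsto (fun x : ℝ => (x : ℂ) ^ (k + 1) * Complex.exp (-(r * x))) atTop (𝓝 0) := by
      rw [tendsto_zero_iff_norm_tendsto_zero]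
      have h := tendsto_rpow_mul_exp_neg_mul_atTop_nhds_zero ((k + 1 : ℕ) : ℝ) r.re hr
      refine h.congr' ?_
      filter_upwards [eventually_gt_atTop 0] with x hx
      rw [norm_pow_mul_cexp _ hx, Real.rpow_natCast, neg_mul]
    have h := integral_Ioi_of_hasDerivAt_of_tendsto' (fun x _ => hd x) (hi.sub hi') hlim
    have h2 := integral_sub hi hi'
    simp only [integral_const_mul] at h2
    rw [h2, ih] at h
    simp only [Complex.ofReal_zero, ne_eq, Nat.add_eq_zero_iff, one_ne_zero, and_false,
      not_false_eq_true, zero_pow, zero_mul, sub_zero, sub_eq_zero] at h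
    rw [eq_div_iff (by positivity), pow_succ r (k + 1), mul_comm (r ^ (k + 1)) r, ← mul_assoc,
      mul_comm _ r, ← h, Nat.factorial_succ]
    push_cast
    field_simp

/-- The Laplace transform of the absolutely continuous part of the Bessel distribution, obtained by
integrating the power series of the density term by term. -/
lemma integral_cexp_mul_besselDensity {α β : ℝ} (hα : 0 < α) (hβ : 0 < β) {u : ℂ}
    (hu : u.re ≤ 0) :
    ∫ x in Ioi (0 : ℝ), Complex.exp (u * x) * (besselDensity α β x : ℂ)
      = Complex.exp (α * u / (β - u)) - Complex.exp (-α) := by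
  have hr : 0 < ((β : ℂ) - u).re := by simp; linarith
  have hr0 : (β : ℂ) - u ≠ 0 := by intro h; rw [h] at hr; simp at hr
  set c : ℕ → ℝ := fun k => Real.exp (-α) * ((α * β) ^ (k + 1) /
      ((k.factorial : ℝ) * ((k + 1).factorial : ℝ))) with hc
  have hc0 : ∀ k, 0 ≤ c k := fun k => by positivity
  set F : ℕ → ℝ → ℂ := fun k x => (c k : ℂ) * ((x : ℂ) ^ k * Complex.exp (-((β - u) * x)))
  have hexp : ∀ z : ℂ, HasSum (fun k : ℕ => z ^ (k + 1) / ((k + 1).factorial : ℂ))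
      (Complex.exp z - 1) := fun z => by
    have h := NormedSpace.expSeries_div_hasSum_exp z
    rw [← Complex.exp_eq_exp_ℂ] at h
    simpa using (hasSum_nat_add_iff' 1).2 h
  have hexpR : ∀ z : ℝ, Summable (fun k : ℕ => z ^ (k + 1) / ((k + 1).factorial : ℝ)) := fun z =>
    (summable_nat_add_iff 1).2 (Real.summable_pow_div_factorial z)
  have hint := hasSum_integral_of_summable_integral_norm (μ := volume.restrict (Ioi (0 : ℝ)))
    (F := F) (fun k => (integrableOn_pow_mul_cexp_Ioi hr k).const_mul _) (by
      have : (fun k => ∫ x in Ioi (0 : ℝ), ‖F k x‖) = fun k : ℕ => Real.exp (-α) *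
          ((α * β / ((β : ℂ) - u).re) ^ (k + 1) / ((k + 1).factorial : ℝ)) := by
        ext k
        simp only [F, norm_mul _ (_ * _), integral_const_mul]
        rw [integral_norm_pow_mul_cexp_Ioi hr, Complex.norm_real, Real.norm_of_nonneg (hc0 k), hc]
        have := k.factorial_pos
        have : ((k.factorial : ℕ) : ℝ) ≠ 0 := by positivity
        rw [div_pow]
        field_simp
      rw [this]
      exact (hexpR _).mul_left _)
  have hval : (fun k => ∫ x in Ioi (0 : ℝ), F k x) = fun k : ℕ => Complex.exp (-α) *
      ((α * β / ((β : ℂ) - u)) ^ (k + 1) / ((k + 1).factorial : ℂ)) := by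
    ext k
    simp only [F, integral_const_mul]
    rw [integral_pow_mul_cexp_Ioi hr, hc]
    have : ((k.factorial : ℕ) : ℂ) ≠ 0 := by exact_mod_cast k.factorial_ne_zero
    push_cast
    rw [div_pow]
    field_simp
  rw [hval] at hint
  have heq := hint.unique ((hexp (α * β / (β - u))).mul_left (Complex.exp (-α)))
  have hcongr : ∫ x in Ioi (0 : ℝ), Complex.exp (u * x) * (besselDensity α β x : ℂ)
      = ∫ x in Ioi (0 : ℝ), ∑' k, F k x := by
    refine setIntegral_congr_fun measurableSet_Ioi fun x hx => ?_
    simp only [F]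
    rw [besselDensity_eq_tsum hα hβ hx, Complex.ofReal_tsum, ← tsum_mul_left]
    refine tsum_congr fun k => ?_
    rw [show -(((β : ℂ) - u) * x) = u * x + (-(β * x)) by ring, Complex.exp_add]
    push_cast [hc]
    ring
  rw [hcongr, heq, mul_sub, ← Complex.exp_add, mul_one]
  congr 2
  field_simp
  ring

lemma integral_besselDensity {α β : ℝ} (hα : 0 < α) (hβ : 0 < β) :
    ∫ x in Ioi (0 : ℝ), besselDensity α β x = 1 - Real.exp (-α) := by
  have h := integral_cexp_mul_besselDensity hα hβ (u := 0) (by simp)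
  simp only [zero_mul, Complex.exp_zero, one_mul, mul_zero, zero_div] at h
  rw [integral_complex_ofReal] at h
  exact_mod_cast h

/-- The integral is nonzero, so the junk value of a non-integrable function is excluded. -/
lemma integrableOn_besselDensity {α β : ℝ} (hα : 0 < α) (hβ : 0 < β) :
    IntegrableOn (besselDensity α β) (Ioi 0) := by
  apply Integrable.of_integral_ne_zero
  rw [integral_besselDensity hα hβ]
  have : Real.exp (-α) < 1 := by simpa using hα
  linarith

lemma lintegral_besselDensity {α β : ℝ} (hα : 0 < α) (hβ : 0 < β) :
    ∫⁻ x in Ioi (0 : ℝ), ENNReal.ofReal (besselDensity α β x)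
      = ENNReal.ofReal (1 - Real.exp (-α)) := by
  rw [← integral_besselDensity hα hβ]
  refine (ofReal_integral_eq_lintegral_ofReal (integrableOn_besselDensity hα hβ) ?_).symm
  filter_upwards [ae_restrict_mem measurableSet_Ioi] with x hx
  exact besselDensity_nonneg hα hβ hx

lemma besselDistribution_inter_Ioi (α β : ℝ) {B : Set ℝ} (hB : MeasurableSet B) :
    besselDistribution α β (B ∩ Ioi 0) = (volume.restrict (Ioi (0 : ℝ))).withDensity
      (fun x => ENNReal.ofReal (besselDensity α β x)) B := by
  rw [besselDistribution, Measure.add_apply, Measure.smul_apply,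
    Measure.dirac_apply' _ (hB.inter measurableSet_Ioi)]
  simp only [mem_inter_iff, mem_Ioi, lt_self_iff_false, and_false, not_false_eq_true,
    indicator_of_notMem, smul_eq_mul, mul_zero, zero_add]
  rw [withDensity_apply _ (hB.inter measurableSet_Ioi), withDensity_apply _ hB,
    Measure.restrict_restrict (hB.inter measurableSet_Ioi), Measure.restrict_restrict hB,
    inter_assoc, inter_self]
  rfl

/-! ### Compound Poisson distributions -/

lemma isProbabilityMeasure_convPower (ρ : Measure ℝ) [IsProbabilityMeasure ρ] (n : ℕ) :
    IsProbabilityMeasure (convPower ρ n) := by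
  induction n with
  | zero => exact inferInstanceAs (IsProbabilityMeasure (Measure.dirac (0 : ℝ)))
  | succ n ih => exact inferInstanceAs (IsProbabilityMeasure (Measure.conv (convPower ρ n) ρ))

/-- The transform of a convolution power is the power of the transform; the same holds for the
integral of the modulus, since `‖e^{u(x + y)}‖ = ‖e^{ux}‖ ‖e^{uy}‖`. -/
lemma integral_cexp_convPower (ρ : Measure ℝ) [IsProbabilityMeasure ρ] {u : ℂ}
    (hu : Integrable (fun x : ℝ => Complex.exp (u * x)) ρ) (n : ℕ) :
    Integrable (fun x : ℝ => Complex.exp (u * x)) (convPower ρ n) ∧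
    ∫ x, Complex.exp (u * (x : ℂ)) ∂(convPower ρ n) = (∫ x, Complex.exp (u * (x : ℂ)) ∂ρ) ^ n ∧
    ∫ x, ‖Complex.exp (u * (x : ℂ))‖ ∂(convPower ρ n)
      = (∫ x, ‖Complex.exp (u * (x : ℂ))‖ ∂ρ) ^ n := by
  induction n with
  | zero =>
    refine ⟨integrable_dirac (by simp), ?_, ?_⟩ <;> simp [convPower, integral_dirac]
  | succ n ih =>
    obtain ⟨h1, h2, h3⟩ := ih
    have := isProbabilityMeasure_convPower ρ n
    have hadd : ∀ x y : ℝ, Complex.exp (u * ((x + y : ℝ) : ℂ))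
        = Complex.exp (u * x) * Complex.exp (u * y) := fun x y => by
      rw [← Complex.exp_add]; push_cast; ring_nf
    have hi : Integrable (fun x : ℝ => Complex.exp (u * x)) (Measure.conv (convPower ρ n) ρ) := by
      rw [integrable_conv_iff (by fun_prop)]
      simp only [hadd, norm_mul, integral_const_mul]
      exact ⟨ae_of_all _ fun x => hu.const_mul _, h1.norm.mul_const _⟩
    refine ⟨hi, ?_, ?_⟩
    · change ∫ x, Complex.exp (u * (x : ℂ)) ∂(Measure.conv (convPower ρ n) ρ) = _
      rw [integral_conv hi]
      simp only [hadd, integral_const_mul, integral_mul_const]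
      rw [h2, pow_succ]
    · change ∫ x, ‖Complex.exp (u * (x : ℂ))‖ ∂(Measure.conv (convPower ρ n) ρ) = _
      rw [integral_conv hi.norm]
      simp only [hadd, norm_mul, integral_const_mul, integral_mul_const]
      rw [h3, pow_succ]

/-- The Lévy–Khintchine formula for the compound Poisson distribution. -/
lemma integral_cexp_compoundPoisson (r : ℝ≥0) (ρ : Measure ℝ) [IsProbabilityMeasure ρ] {u : ℂ}
    (hu : Integrable (fun x : ℝ => Complex.exp (u * x)) ρ) :
    ∫ x, Complex.exp (u * (x : ℂ)) ∂(compoundPoisson r ρ)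
      = Complex.exp (r * (∫ x, Complex.exp (u * (x : ℂ)) ∂ρ) - r) := by
  have hw : ∀ n : ℕ, 0 ≤ Real.exp (-(r : ℝ)) * (r : ℝ) ^ n / (n.factorial : ℝ) :=
    fun n => by positivity
  have hint : Integrable (fun x : ℝ => Complex.exp (u * x)) (compoundPoisson r ρ) := by
    refine integrable_sum_measure (fun n =>
      ((integral_cexp_convPower ρ hu n).1).smul_measure ENNReal.ofReal_ne_top) ?_
    simp only [integral_smul_measure, (integral_cexp_convPower ρ hu _).2.2,
      ENNReal.toReal_ofReal (hw _), smul_eq_mul]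
    refine ((Real.summable_pow_div_factorial
      (r * ∫ x, ‖Complex.exp (u * (x : ℂ))‖ ∂ρ)).mul_left (Real.exp (-(r : ℝ)))).congr fun n => ?_
    rw [mul_pow]; ring
  rw [compoundPoisson, integral_sum_measure hint]
  simp only [integral_smul_measure, (integral_cexp_convPower ρ hu _).2.1,
      ENNReal.toReal_ofReal (hw _), Complex.real_smul]
  have h := (NormedSpace.expSeries_div_hasSum_exp
    ((r : ℂ) * ∫ x, Complex.exp (u * (x : ℂ)) ∂ρ)).mul_left (Complex.exp (-(r : ℂ)))
  rw [← Complex.exp_eq_exp_ℂ, ← Complex.exp_add] at h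
  rw [sub_eq_neg_add, ← h.tsum_eq]
  refine tsum_congr fun n => ?_
  push_cast
  rw [mul_pow]; ring

/-! ### Finiteness of the jump intensity -/

lemma IsPositiveJumpLevyMeasure.restrict_Ioi {ν : Measure ℝ} (hν : IsPositiveJumpLevyMeasure ν) :
    ν.restrict (Ioi 0) = ν :=
  Measure.restrict_eq_self_of_ae_mem (by
    rw [ae_iff]
    simpa [Iic, not_lt] using hν.concentrated)

lemma IsPositiveJumpLevyMeasure.sFinite {ν : Measure ℝ} (hν : IsPositiveJumpLevyMeasure ν) :
    SFinite ν := by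
  -- `ν` has the density `1 / min ξ 1` with respect to a finite measure.
  have hfin : IsFiniteMeasure
      ((ν.restrict (Ioi 0)).withDensity fun ξ => ENNReal.ofReal (min ξ 1)) :=
    isFiniteMeasure_withDensity hν.finite_min.ne
  have h := withDensity_inv_same₀ (μ := ν.restrict (Ioi 0))
    (f := fun ξ => ENNReal.ofReal (min ξ 1)) (by fun_prop)
    (by
      filter_upwards [ae_restrict_mem measurableSet_Ioi] with ξ hξ
      have : 0 < min ξ 1 := lt_min hξ one_pos
      simpa using this) (ae_of_all _ fun _ => ENNReal.ofReal_ne_top)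
  rw [← hν.restrict_Ioi, ← h]
  infer_instance

lemma measurable_jcirAlpha (a σ : ℝ) : Measurable fun p : ℝ × ℝ => jcirAlpha a σ p.1 p.2 := by
  unfold jcirAlpha; fun_prop

lemma measurable_jcirBeta (a σ : ℝ) : Measurable fun s : ℝ => jcirBeta a σ s := by
  unfold jcirBeta; fun_prop

lemma exp_mul_sub_one_pos {a s : ℝ} (ha : 0 < a) (hs : 0 < s) : 0 < Real.exp (a * s) - 1 := by
  have : 1 < Real.exp (a * s) := Real.one_lt_exp_iff.2 (by positivity)
  linarith

lemma jcirAlpha_pos {a σ s ξ : ℝ} (ha : 0 < a) (hσ : 0 < σ) (hs : 0 < s) (hξ : 0 < ξ) :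
    0 < jcirAlpha a σ s ξ := by
  have := exp_mul_sub_one_pos ha hs
  unfold jcirAlpha; positivity

lemma jcirBeta_pos {a σ s : ℝ} (ha : 0 < a) (hσ : 0 < σ) (hs : 0 < s) :
    0 < jcirBeta a σ s := by
  have := exp_mul_sub_one_pos ha hs
  unfold jcirBeta; positivity

lemma one_sub_exp_neg_jcirAlpha_le {a σ s ξ : ℝ} (ha : 0 < a) (hσ : 0 < σ) (hs : 0 < s)
    (hξ : 0 < ξ) : 1 - Real.exp (-jcirAlpha a σ s ξ) ≤ 2 / σ ^ 2 * ξ / s := by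
  have h1 : 1 - Real.exp (-jcirAlpha a σ s ξ) ≤ jcirAlpha a σ s ξ := by
    have := Real.add_one_le_exp (-jcirAlpha a σ s ξ)
    linarith
  refine h1.trans ?_
  have h2 : a * s ≤ Real.exp (a * s) - 1 := by
    have := Real.add_one_le_exp (a * s)
    linarith
  calc jcirAlpha a σ s ξ ≤ 2 * a * ξ / (σ ^ 2 * (a * s)) := by unfold jcirAlpha; gcongr
    _ = 2 / σ ^ 2 * ξ / s := by field_simp

/-- The time integral of `1 - e^{-α(s, ξ)} ≤ min 1 (2ξ / (σ² s))` grows like `ξ log (1 / ξ)` for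
small jumps; this is the source of the logarithmic moment condition. -/
lemma lintegral_one_sub_exp_neg_jcirAlpha_le {a σ t ξ : ℝ} (ha : 0 < a) (hσ : 0 < σ) (ht : 0 < t)
    (hξ : 0 < ξ) :
    ∫⁻ s in Ioc (0 : ℝ) t, ENNReal.ofReal (1 - Real.exp (-jcirAlpha a σ s ξ))
      ≤ ENNReal.ofReal (1 + 2 / σ ^ 2 * Real.log (max t 1) + t) * ENNReal.ofReal (min ξ 1)
        + ENNReal.ofReal (2 / σ ^ 2) *
          (Ioo 0 1).indicator (fun ξ => ENNReal.ofReal (ξ * Real.log (1 / ξ))) ξ := by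
  have hT1 : 1 ≤ max t 1 := le_max_right _ _
  have hlogT : 0 ≤ Real.log (max t 1) := Real.log_nonneg hT1
  have hone : ∀ s, ENNReal.ofReal (1 - Real.exp (-jcirAlpha a σ s ξ)) ≤ 1 := fun s => by
    rw [← ENNReal.ofReal_one]
    exact ENNReal.ofReal_le_ofReal (by linarith [Real.exp_pos (-jcirAlpha a σ s ξ)])
  rcases lt_or_ge ξ 1 with h1 | h1
  · -- For `s ≤ ξ` the integrand is bounded by `1`, for `s > ξ` by `2ξ / (σ² s)`.
    have hsub : Ioc (0 : ℝ) t ⊆ Ioc 0 ξ ∪ Ioc ξ (max t 1) := by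
      rw [Ioc_union_Ioc_eq_Ioc hξ.le (h1.le.trans hT1)]
      exact Ioc_subset_Ioc_right (le_max_left _ _)
    have hsmall : ∫⁻ s in Ioc (0 : ℝ) ξ, ENNReal.ofReal (1 - Real.exp (-jcirAlpha a σ s ξ))
        ≤ ENNReal.ofReal ξ := by
      calc _ ≤ ∫⁻ s in Ioc (0 : ℝ) ξ, 1 := lintegral_mono fun s => hone s
        _ = ENNReal.ofReal ξ := by simp
    have hlarge : ∫⁻ s in Ioc ξ (max t 1), ENNReal.ofReal (1 - Real.exp (-jcirAlpha a σ s ξ))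
        ≤ ENNReal.ofReal (2 / σ ^ 2 * ξ * (Real.log (max t 1) + Real.log (1 / ξ))) := by
      have hii : IntervalIntegrable (fun s : ℝ => s⁻¹) volume ξ (max t 1) :=
        ContinuousOn.intervalIntegrable (continuousOn_inv₀.mono fun s hs => by
          rw [uIcc_of_le (h1.le.trans hT1)] at hs
          exact (hξ.trans_le hs.1).ne')
      have hval : ∫ s in ξ..(max t 1), 2 / σ ^ 2 * ξ * s⁻¹
          = 2 / σ ^ 2 * ξ * (Real.log (max t 1) + Real.log (1 / ξ)) := by
        rw [intervalIntegral.integral_const_mul, integral_inv_of_pos hξ (by positivity),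
          Real.log_div (by positivity) hξ.ne', one_div, Real.log_inv]
        ring
      rw [← hval, intervalIntegral.integral_of_le (h1.le.trans hT1),
        ofReal_integral_eq_lintegral_ofReal]
      · refine setLIntegral_mono' measurableSet_Ioc fun s hs => ENNReal.ofReal_le_ofReal ?_
        rw [← div_eq_mul_inv]
        exact one_sub_exp_neg_jcirAlpha_le ha hσ (hξ.trans hs.1) hξ
      · exact (hii.1.const_mul _)
      · filter_upwards [ae_restrict_mem measurableSet_Ioc] with s hs
        have : 0 < s := hξ.trans hs.1
        change 0 ≤ 2 / σ ^ 2 * ξ * s⁻¹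
        positivity
    have hlogξ : 0 ≤ Real.log (1 / ξ) := Real.log_nonneg (by rw [le_div_iff₀ hξ]; linarith)
    rw [min_eq_left h1.le, indicator_of_mem (show ξ ∈ Ioo (0 : ℝ) 1 from ⟨hξ, h1⟩)]
    rw [← ENNReal.ofReal_mul (by positivity), ← ENNReal.ofReal_mul (by positivity),
      ← ENNReal.ofReal_add (by positivity) (by positivity)]
    calc _ ≤ _ := lintegral_mono_set hsub
      _ ≤ _ := lintegral_union_le _ _ _
      _ ≤ _ := add_le_add hsmall hlarge
      _ = ENNReal.ofReal (ξ + 2 / σ ^ 2 * ξ * (Real.log (max t 1) + Real.log (1 / ξ))) :=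
        (ENNReal.ofReal_add hξ.le (by positivity)).symm
      _ ≤ _ := ENNReal.ofReal_le_ofReal (by nlinarith [mul_pos ht hξ])
  · refine le_add_right ?_
    rw [min_eq_right h1, ENNReal.ofReal_one, mul_one]
    calc _ ≤ ∫⁻ s in Ioc (0 : ℝ) t, 1 := lintegral_mono fun s => hone s
      _ = ENNReal.ofReal t := by simp
      _ ≤ _ := ENNReal.ofReal_le_ofReal (by
        have : 0 ≤ 2 / σ ^ 2 * Real.log (max t 1) := by positivity
        linarith)

lemma lintegral_jump_intensity_lt_top {a σ t : ℝ} (ha : 0 < a) (hσ : 0 < σ) (ht : 0 < t)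
    {ν : Measure ℝ} (hν : IsPositiveJumpLevyMeasure ν)
    (hlog : ∫⁻ ξ in Ioo (0 : ℝ) 1, ENNReal.ofReal (ξ * Real.log (1 / ξ)) ∂ν < ∞) :
    ∫⁻ s in Ioc (0 : ℝ) t, ∫⁻ ξ in Ioi (0 : ℝ),
        ENNReal.ofReal (1 - Real.exp (-jcirAlpha a σ s ξ)) ∂ν < ∞ := by
  have := hν.sFinite
  have hmeas := measurable_jcirAlpha a σ
  rw [lintegral_lintegral_swap (by unfold Function.uncurry; fun_prop)]
  refine (setLIntegral_mono' measurableSet_Ioi fun ξ hξ =>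
    lintegral_one_sub_exp_neg_jcirAlpha_le ha hσ ht hξ).trans_lt ?_
  rw [lintegral_add_left (by fun_prop), lintegral_const_mul _ (by fun_prop),
    lintegral_const_mul _ (Measurable.indicator (by fun_prop) measurableSet_Ioo),
    lintegral_indicator measurableSet_Ioo, Measure.restrict_restrict measurableSet_Ioo,
    inter_eq_left.2 Ioo_subset_Ioi_self]
  exact ENNReal.add_lt_top.2 ⟨ENNReal.mul_lt_top ENNReal.ofReal_lt_top hν.finite_min,
    ENNReal.mul_lt_top ENNReal.ofReal_lt_top hlog⟩

/-! ### The mixture of Bessel distributions -/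

/-- The exponent `ξ ψ(s, u)` is the cumulant of the Bessel distribution with parameters `α(s, ξ)`
and `β(s)`. -/
lemma jcirAlpha_mul_div_jcirBeta_sub {a σ s ξ : ℝ} (ha : 0 < a) (hσ : 0 < σ) (hs : 0 < s) {u : ℂ}
    (hu : u.re ≤ 0) :
    (jcirAlpha a σ s ξ : ℂ) * u / (jcirBeta a σ s - u) = ξ * jcirPsi a σ s u := by
  have hE := exp_mul_sub_one_pos ha hs
  have hpos := Real.exp_pos (a * s)
  rw [jcirPsi, neg_mul, Real.exp_neg, jcirAlpha, jcirBeta]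
  set E : ℝ := Real.exp (a * s)
  have h1 : ((E - 1 : ℝ) : ℂ) ≠ 0 := by exact_mod_cast hE.ne'
  have h2 : (E : ℂ) ≠ 0 := by exact_mod_cast hpos.ne'
  have h3 : (a : ℂ) ≠ 0 := by exact_mod_cast ha.ne'
  have h4 : (σ : ℂ) ≠ 0 := by exact_mod_cast hσ.ne'
  have hden : (2 * a * E - u * (σ ^ 2 * ((E - 1 : ℝ) : ℂ)) : ℂ) ≠ 0 := fun h => by
    have := congrArg Complex.re h
    have h5 : (2 * a * E - u * (σ ^ 2 * ((E - 1 : ℝ) : ℂ)) : ℂ).re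
        = 2 * a * E - u.re * (σ ^ 2 * (E - 1)) := by
      rw [show (2 * a * E - u * (σ ^ 2 * ((E - 1 : ℝ) : ℂ)) : ℂ)
        = ((2 * a * E : ℝ) : ℂ) - u * ((σ ^ 2 * (E - 1) : ℝ) : ℂ) by push_cast; ring,
        Complex.sub_re, Complex.re_mul_ofReal, Complex.ofReal_re]
    rw [h5, Complex.zero_re] at this
    have : 0 < 2 * a * E := by positivity
    have : 0 < σ ^ 2 * (E - 1) := by positivity
    nlinarith
  have hL : ((2 * a * E / (σ ^ 2 * (E - 1)) : ℝ) : ℂ) - u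
      = (2 * a * E - u * (σ ^ 2 * ((E - 1 : ℝ) : ℂ))) / (σ ^ 2 * ((E - 1 : ℝ) : ℂ)) := by
    push_cast at h1 ⊢
    field_simp
  have hR : 1 - ((σ ^ 2 / (2 * a) : ℝ) : ℂ) * u * (1 - ((E⁻¹ : ℝ) : ℂ))
      = (2 * a * E - u * (σ ^ 2 * ((E - 1 : ℝ) : ℂ))) / (2 * a * E) := by
    push_cast
    field_simp
  rw [hL, hR]
  push_cast at h1 hden ⊢
  field_simp

lemma measurable_besselDensity_jcir (a σ : ℝ) : Measurable (Function.uncurry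
    fun (p : ℝ × ℝ) (x : ℝ) =>
      ENNReal.ofReal (besselDensity (jcirAlpha a σ p.1 p.2) (jcirBeta a σ p.1) x)) := by
  have h1 : Measurable fun q : (ℝ × ℝ) × ℝ => jcirAlpha a σ q.1.1 q.1.2 :=
    (measurable_jcirAlpha a σ).comp measurable_fst
  have h2 : Measurable fun q : (ℝ × ℝ) × ℝ => jcirBeta a σ q.1.1 :=
    (measurable_jcirBeta a σ).comp (measurable_fst.comp measurable_fst)
  have h3 := measurable_besselIOne
  unfold besselDensity Function.uncurry
  fun_prop

/-- The kernel sending `(s, ξ)` to the restriction to `(0, ∞)` of the Bessel distribution with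
parameters `α(s, ξ)` and `β(s)`. -/
noncomputable def jcirBesselKernel (a σ : ℝ) : Kernel (ℝ × ℝ) ℝ :=
  Kernel.withDensity (Kernel.const _ (volume.restrict (Ioi (0 : ℝ)))) fun p x =>
    ENNReal.ofReal (besselDensity (jcirAlpha a σ p.1 p.2) (jcirBeta a σ p.1) x)

instance (a σ : ℝ) : IsSFiniteKernel (jcirBesselKernel a σ) :=
  Kernel.IsSFiniteKernel.withDensity _ fun _ _ => ENNReal.ofReal_ne_top

lemma jcirBesselKernel_eq (a σ : ℝ) (p : ℝ × ℝ) :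
    jcirBesselKernel a σ p = (volume.restrict (Ioi (0 : ℝ))).withDensity
      fun x => ENNReal.ofReal (besselDensity (jcirAlpha a σ p.1 p.2) (jcirBeta a σ p.1) x) := by
  rw [jcirBesselKernel, Kernel.withDensity_apply _ (measurable_besselDensity_jcir a σ),
    Kernel.const_apply]

lemma jcirBesselKernel_apply (a σ : ℝ) (p : ℝ × ℝ) {B : Set ℝ} (hB : MeasurableSet B) :
    jcirBesselKernel a σ p B
      = besselDistribution (jcirAlpha a σ p.1 p.2) (jcirBeta a σ p.1) (B ∩ Ioi 0) := by
  rw [jcirBesselKernel_eq, besselDistribution_inter_Ioi _ _ hB]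

lemma jcirBesselKernel_univ {a σ : ℝ} (ha : 0 < a) (hσ : 0 < σ) {p : ℝ × ℝ} (h1 : 0 < p.1)
    (h2 : 0 < p.2) :
    jcirBesselKernel a σ p univ = ENNReal.ofReal (1 - Real.exp (-jcirAlpha a σ p.1 p.2)) := by
  rw [jcirBesselKernel_eq, withDensity_apply _ MeasurableSet.univ, Measure.restrict_univ]
  exact lintegral_besselDensity (jcirAlpha_pos ha hσ h1 h2) (jcirBeta_pos ha hσ h1)

lemma norm_cexp_mul_le_one {u : ℂ} (hu : u.re ≤ 0) {x : ℝ} (hx : 0 < x) :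
    ‖Complex.exp (u * x)‖ ≤ 1 := by
  rw [Complex.norm_exp, Complex.re_mul_ofReal, Real.exp_le_one_iff]
  exact mul_nonpos_of_nonpos_of_nonneg hu hx.le

lemma integral_cexp_sub_one_jcirBesselKernel {a σ : ℝ} (ha : 0 < a) (hσ : 0 < σ) {p : ℝ × ℝ}
    (h1 : 0 < p.1) (h2 : 0 < p.2) {u : ℂ} (hu : u.re ≤ 0) :
    ∫ x, (Complex.exp (u * (x : ℂ)) - 1) ∂(jcirBesselKernel a σ p)
      = Complex.exp ((p.2 : ℂ) * jcirPsi a σ p.1 u) - 1 := by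
  have hα := jcirAlpha_pos ha hσ h1 h2
  have hβ := jcirBeta_pos ha hσ h1
  have hm : Measurable fun x : ℝ =>
      besselDensity (jcirAlpha a σ p.1 p.2) (jcirBeta a σ p.1) x := by
    have h3 := measurable_besselIOne
    unfold besselDensity; fun_prop
  have hi : Integrable (fun x : ℝ =>
      (besselDensity (jcirAlpha a σ p.1 p.2) (jcirBeta a σ p.1) x : ℂ))
      (volume.restrict (Ioi 0)) := (integrableOn_besselDensity hα hβ).ofReal
  have hie : Integrable (fun x : ℝ => Complex.exp (u * x) *
      (besselDensity (jcirAlpha a σ p.1 p.2) (jcirBeta a σ p.1) x : ℂ))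
      (volume.restrict (Ioi 0)) := by
    refine hi.bdd_mul (c := 1) (by fun_prop) ?_
    filter_upwards [ae_restrict_mem measurableSet_Ioi] with x hx
    exact norm_cexp_mul_le_one hu hx
  rw [jcirBesselKernel_eq, integral_withDensity_eq_integral_toReal_smul hm.ennreal_ofReal
    (ae_of_all _ fun _ => ENNReal.ofReal_lt_top)]
  calc _ = ∫ x in Ioi (0 : ℝ), (Complex.exp (u * x) *
        (besselDensity (jcirAlpha a σ p.1 p.2) (jcirBeta a σ p.1) x : ℂ)
        - (besselDensity (jcirAlpha a σ p.1 p.2) (jcirBeta a σ p.1) x : ℂ)) := by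
        refine setIntegral_congr_fun measurableSet_Ioi fun x hx => ?_
        simp only [ENNReal.toReal_ofReal (besselDensity_nonneg hα hβ hx), Complex.real_smul]
        ring
    _ = _ := by
        rw [integral_sub hie hi, integral_cexp_mul_besselDensity hα hβ hu,
          integral_complex_ofReal, integral_besselDensity hα hβ,
          jcirAlpha_mul_div_jcirBeta_sub ha hσ h1 hu]
        push_cast
        ring

/-- The measure `B ↦ ∫₀ᵗ ∫ μ_{α(s,ξ),β(s)}(B ∩ (0, ∞)) ν(dξ) ds`, the mixture of the restricted
Bessel distributions, realized as the marginal of a composition-product. -/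
noncomputable def jcirJumpMeasure (a σ : ℝ) (ν : Measure ℝ) (t : ℝ) : Measure ℝ :=
  (((volume.restrict (Ioc 0 t)).prod (ν.restrict (Ioi 0))) ⊗ₘ jcirBesselKernel a σ).snd

lemma jcirJumpMeasure_apply (a σ : ℝ) (ν : Measure ℝ) [SFinite ν] (t : ℝ) {B : Set ℝ}
    (hB : MeasurableSet B) :
    jcirJumpMeasure a σ ν t B = ∫⁻ s in Ioc (0 : ℝ) t, ∫⁻ ξ in Ioi (0 : ℝ),
          besselDistribution (jcirAlpha a σ s ξ) (jcirBeta a σ s) (B ∩ Ioi 0) ∂ν := by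
  rw [jcirJumpMeasure, Measure.snd_apply hB, Measure.compProd_apply (measurable_snd hB)]
  rw [lintegral_prod _ (by
    have := (jcirBesselKernel a σ).measurable_coe hB
    exact this.aemeasurable)]
  refine lintegral_congr fun s => lintegral_congr fun ξ => ?_
  exact jcirBesselKernel_apply a σ (s, ξ) hB

lemma ae_prod_pos (t : ℝ) (ν : Measure ℝ) [SFinite ν] :
    ∀ᵐ p ∂((volume.restrict (Ioc (0 : ℝ) t)).prod (ν.restrict (Ioi 0))), 0 < p.1 ∧ 0 < p.2 := by
  rw [Measure.prod_restrict]
  filter_upwards [ae_restrict_mem (measurableSet_Ioc.prod measurableSet_Ioi)] with p hp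
  exact ⟨hp.1.1, hp.2⟩

lemma jcirJumpMeasure_univ {a σ : ℝ} (ha : 0 < a) (hσ : 0 < σ) (ν : Measure ℝ) [SFinite ν]
    (t : ℝ) : jcirJumpMeasure a σ ν t univ = ∫⁻ s in Ioc (0 : ℝ) t, ∫⁻ ξ in Ioi (0 : ℝ),
        ENNReal.ofReal (1 - Real.exp (-jcirAlpha a σ s ξ)) ∂ν := by
  rw [jcirJumpMeasure_apply _ _ _ _ MeasurableSet.univ]
  refine setLIntegral_congr_fun measurableSet_Ioc fun s hs =>
    setLIntegral_congr_fun measurableSet_Ioi fun ξ hξ => ?_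
  have h := jcirBesselKernel_apply a σ (s, ξ) MeasurableSet.univ
  rw [jcirBesselKernel_univ ha hσ (p := (s, ξ)) hs.1 hξ] at h
  exact h.symm

lemma jcirJumpMeasure_Iic (a σ : ℝ) (ν : Measure ℝ) [SFinite ν] (t : ℝ) :
    jcirJumpMeasure a σ ν t (Iic 0) = 0 := by
  rw [jcirJumpMeasure_apply _ _ _ _ measurableSet_Iic, Iic_inter_Ioi, Ioc_self]
  simp

lemma jcirJumpMeasure_univ_pos {a σ t : ℝ} (ha : 0 < a) (hσ : 0 < σ) (ht : 0 < t) {ν : Measure ℝ}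
    (hν : IsPositiveJumpLevyMeasure ν) (h0 : ν ≠ 0) : 0 < jcirJumpMeasure a σ ν t univ := by
  have := hν.sFinite
  have hα := measurable_jcirAlpha a σ
  rw [jcirJumpMeasure_univ ha hσ,
    ← lintegral_prod (μ := volume.restrict (Ioc 0 t)) (ν := ν.restrict (Ioi 0))
      (fun p => ENNReal.ofReal (1 - Real.exp (-jcirAlpha a σ p.1 p.2))) (by fun_prop),
    lintegral_pos_iff_support (by fun_prop)]
  have hfull : (Function.support fun p : ℝ × ℝ =>
      ENNReal.ofReal (1 - Real.exp (-jcirAlpha a σ p.1 p.2)))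
      =ᵐ[(volume.restrict (Ioc (0 : ℝ) t)).prod (ν.restrict (Ioi 0))] univ := by
    rw [eventuallyEq_univ]
    filter_upwards [ae_prod_pos t ν] with p hp
    have : Real.exp (-jcirAlpha a σ p.1 p.2) < 1 := by
      simpa using jcirAlpha_pos ha hσ hp.1 hp.2
    simpa using this
  rw [measure_congr hfull, hν.restrict_Ioi, ← univ_prod_univ, Measure.prod_prod]
  refine ENNReal.mul_pos (by simpa using ht) ?_
  simpa using h0

lemma ae_jcirJumpMeasure_pos (a σ : ℝ) (ν : Measure ℝ) [SFinite ν] (t : ℝ) :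
    ∀ᵐ x ∂(jcirJumpMeasure a σ ν t), 0 < x := by
  rw [ae_iff]
  simpa [Iic, not_lt] using jcirJumpMeasure_Iic a σ ν t

lemma integrable_cexp_of_ae_pos {ρ : Measure ℝ} [IsFiniteMeasure ρ] (hρ : ∀ᵐ x ∂ρ, 0 < x) {u : ℂ}
    (hu : u.re ≤ 0) : Integrable (fun x : ℝ => Complex.exp (u * x)) ρ := by
  refine Integrable.of_bound (by fun_prop) 1 ?_
  filter_upwards [hρ] with x hx using norm_cexp_mul_le_one hu hx

lemma integral_cexp_sub_one_jcirJumpMeasure {a σ : ℝ} (ha : 0 < a) (hσ : 0 < σ) (ν : Measure ℝ)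
    [SFinite ν] {t : ℝ} (ht : 0 < t) [IsFiniteMeasure (jcirJumpMeasure a σ ν t)] {u : ℂ}
    (hu : u.re ≤ 0) :
    ∫ x, (Complex.exp (u * (x : ℂ)) - 1) ∂(jcirJumpMeasure a σ ν t)
      = ∫ s in (0 : ℝ)..t, ∫ ξ in Ioi (0 : ℝ),
          (Complex.exp ((ξ : ℂ) * jcirPsi a σ s u) - 1) ∂ν := by
  set m := (volume.restrict (Ioc (0 : ℝ) t)).prod (ν.restrict (Ioi 0)) with hm
  have hint : Integrable (fun x : ℝ => Complex.exp (u * x) - 1) (jcirJumpMeasure a σ ν t) :=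
    (integrable_cexp_of_ae_pos (ae_jcirJumpMeasure_pos a σ ν t) hu).sub (integrable_const 1)
  have hint' : Integrable (fun q : (ℝ × ℝ) × ℝ => Complex.exp (u * q.2) - 1)
      (m ⊗ₘ jcirBesselKernel a σ) :=
    (integrable_map_measure hint.aestronglyMeasurable measurable_snd.aemeasurable).1 hint
  have hae : ∀ᵐ p ∂m, ∫ x, (Complex.exp (u * (x : ℂ)) - 1) ∂(jcirBesselKernel a σ p)
      = Complex.exp ((p.2 : ℂ) * jcirPsi a σ p.1 u) - 1 := by
    filter_upwards [ae_prod_pos t ν] with p hp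
    exact integral_cexp_sub_one_jcirBesselKernel ha hσ hp.1 hp.2 hu
  have hintp : Integrable (fun p : ℝ × ℝ => Complex.exp ((p.2 : ℂ) * jcirPsi a σ p.1 u) - 1) m :=
    Integrable.congr (by
      have h := Integrable.integral_compProd (κ := Kernel.const Unit m) (a := ()) hint'
      simpa using h) hae
  calc ∫ x, (Complex.exp (u * (x : ℂ)) - 1) ∂(jcirJumpMeasure a σ ν t)
      = ∫ q, (Complex.exp (u * ((q.2 : ℝ) : ℂ)) - 1) ∂(m ⊗ₘ jcirBesselKernel a σ) :=
        integral_map measurable_snd.aemeasurable hint.aestronglyMeasurable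
    _ = ∫ p, (Complex.exp ((p.2 : ℂ) * jcirPsi a σ p.1 u) - 1) ∂m := by
        rw [Measure.integral_compProd hint']
        exact integral_congr_ae hae
    _ = _ := by
        rw [hm, integral_prod _ hintp, intervalIntegral.integral_of_le ht.le]

/-- The factor `II(t, ·)` is the transform of a compound Poisson distribution whose jumps are
distributed according to the normalized mixture of Bessel distributions. -/
theorem exists_compoundPoisson_jcirFactorII {a σ : ℝ} (ha : 0 < a) (hσ : 0 < σ) {ν : Measure ℝ}
    (hν : IsPositiveJumpLevyMeasure ν)
    (hlog : ∫⁻ ξ in Ioo (0 : ℝ) 1, ENNReal.ofReal (ξ * Real.log (1 / ξ)) ∂ν < ∞) {t : ℝ}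
    (ht : 0 < t) : ∃ (r : ℝ≥0) (ρ : Measure ℝ),
      IsProbabilityMeasure ρ ∧ ρ (Iic 0) = 0 ∧ (ν ≠ 0 → 0 < r) ∧
      (r : ℝ≥0∞) = ∫⁻ s in Ioc (0 : ℝ) t, ∫⁻ ξ in Ioi (0 : ℝ),
        ENNReal.ofReal (1 - Real.exp (-jcirAlpha a σ s ξ)) ∂ν ∧
      (∀ B : Set ℝ, MeasurableSet B →
        (r : ℝ≥0∞) * ρ B = ∫⁻ s in Ioc (0 : ℝ) t, ∫⁻ ξ in Ioi (0 : ℝ),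
          besselDistribution (jcirAlpha a σ s ξ) (jcirBeta a σ s) (B ∩ Ioi 0) ∂ν) ∧
      (∀ u : ℂ, u.re ≤ 0 →
        ∫ x : ℝ, Complex.exp (u * (x : ℂ)) ∂(compoundPoisson r ρ) = jcirFactorII a σ ν t u) := by
  have := hν.sFinite
  set M := jcirJumpMeasure a σ ν t with hM
  have hMfin : M univ < ∞ := by
    rw [hM, jcirJumpMeasure_univ ha hσ]
    exact lintegral_jump_intensity_lt_top ha hσ ht hν hlog
  have : IsFiniteMeasure M := ⟨hMfin⟩
  set r : ℝ≥0 := (M univ).toNNReal with hr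
  have hrM : (r : ℝ≥0∞) = M univ := ENNReal.coe_toNNReal hMfin.ne
  -- For `ν = 0` the mixture vanishes and any law on `(0, ∞)` serves as jump distribution.
  obtain ⟨ρ, hρ1, hρ0, hρM⟩ : ∃ ρ : Measure ℝ, IsProbabilityMeasure ρ ∧ ρ (Iic 0) = 0 ∧
      (r : ℝ≥0∞) • ρ = M := by
    by_cases h0 : M univ = 0
    · refine ⟨Measure.dirac 1, inferInstance, by simp, ?_⟩
      rw [hrM, h0, zero_smul, Measure.measure_univ_eq_zero.1 h0]
    · refine ⟨(M univ)⁻¹ • M, ⟨?_⟩, ?_, ?_⟩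
      · simp [ENNReal.inv_mul_cancel h0 hMfin.ne]
      · simp [hM, jcirJumpMeasure_Iic]
      · rw [hrM, smul_smul, ENNReal.mul_inv_cancel h0 hMfin.ne, one_smul]
  refine ⟨r, ρ, hρ1, hρ0, fun h0 => ?_, ?_, fun B hB => ?_, fun u hu => ?_⟩
  · have := jcirJumpMeasure_univ_pos ha hσ ht hν h0
    rw [← hM, ← hrM] at this
    exact_mod_cast this
  · rw [hrM, hM, jcirJumpMeasure_univ ha hσ]
  · rw [← jcirJumpMeasure_apply a σ ν t hB, ← hM, ← hρM]; rfl
  · have hρpos : ∀ᵐ x ∂ρ, 0 < x := by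
      rw [ae_iff]; simpa [Iic, not_lt] using hρ0
    have hie := integrable_cexp_of_ae_pos hρpos hu
    rw [integral_cexp_compoundPoisson r ρ hie, jcirFactorII,
      ← integral_cexp_sub_one_jcirJumpMeasure ha hσ ν ht hu, ← hM, ← hρM, integral_smul_measure,
      integral_sub hie (integrable_const 1)]
    simp [mul_sub]

/-! ### Dynkin's formula for the martingale problem -/

/-- A process with right-continuous paths is jointly measurable up to a null set: it is the limit
of its values at the grid times `(⌊(n + 1) s⌋ + 1) / (n + 1)` approaching `s` from the
right. -/
lemma aemeasurable_uncurry_of_rightContinuous {Ω : Type*} [MeasurableSpace Ω] {P : Measure Ω}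
    [SFinite P] {X : ℝ≥0 → Ω → ℝ} (hX : ∀ t, Measurable (X t))
    (hc : ∀ᵐ ω ∂P, ∀ t, ContinuousWithinAt (fun t => X t ω) (Ici t) t) (μ : Measure ℝ) [SFinite μ] :
    AEMeasurable (fun p : ℝ × Ω => X p.1.toNNReal p.2) (μ.prod P) := by
  set τ : ℕ → ℕ → ℝ≥0 := fun n k => ((k : ℝ≥0) + 1) / ((n : ℝ≥0) + 1)
  refine aemeasurable_of_tendsto_metrizable_ae atTop
    (f := fun n (p : ℝ × Ω) => X (τ n ⌊((n : ℝ≥0) + 1) * p.1.toNNReal⌋₊) p.2) (fun n => ?_) ?_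
  · have h1 : Measurable fun q : ℕ × Ω => X (τ n q.1) q.2 :=
      measurable_from_prod_countable_right fun k => show Measurable (X (τ n k)) from hX _
    have h2 : Measurable fun p : ℝ × Ω => (⌊((n : ℝ≥0) + 1) * p.1.toNNReal⌋₊, p.2) :=
      (Nat.measurable_floor.comp (by fun_prop)).prodMk measurable_snd
    exact (h1.comp h2).aemeasurable
  · filter_upwards [Measure.quasiMeasurePreserving_snd.ae hc] with p hp
    refine (hp p.1.toNNReal).tendsto.comp (tendsto_nhdsWithin_iff.2 ⟨?_, ?_⟩)
    · set s := p.1.toNNReal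
      have hinv : Tendsto (fun n : ℕ => s + 1 / ((n : ℝ≥0) + 1)) atTop (𝓝 (s + 0)) :=
        tendsto_const_nhds.add tendsto_one_div_add_atTop_nhds_zero_nat
      rw [add_zero] at hinv
      refine tendsto_of_tendsto_of_tendsto_of_le_of_le tendsto_const_nhds hinv (fun n => ?_)
        fun n => ?_
      · have := (Nat.lt_floor_add_one (((n : ℝ≥0) + 1) * s)).le
        rw [le_div_iff₀ (by positivity), mul_comm]
        exact this
      · have := Nat.floor_le (a := ((n : ℝ≥0) + 1) * s) (by positivity)
        simp only [τ]
        rw [div_le_iff₀ (by positivity), show (s + 1 / ((n : ℝ≥0) + 1)) * ((n : ℝ≥0) + 1)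
          = ((n : ℝ≥0) + 1) * s + 1 by field_simp]
        gcongr
    · refine Eventually.of_forall fun n => ?_
      have := (Nat.lt_floor_add_one (((n : ℝ≥0) + 1) * p.1.toNNReal)).le
      simp only [mem_Ici, τ]
      rw [le_div_iff₀ (by positivity), mul_comm]
      exact this

lemma measurable_jcirGenerator (a θ σ : ℝ) (ν : Measure ℝ) [SFinite ν] {f : ℝ → ℝ}
    (hf : Continuous f) : Measurable (jcirGenerator a θ σ ν f) := by
  unfold jcirGenerator
  have h : StronglyMeasurable fun x => ∫ ξ in Ioi (0 : ℝ), (f (x + ξ) - f x) ∂ν := by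
    refine StronglyMeasurable.integral_prod_right (f := fun x ξ => f (x + ξ) - f x) ?_
    exact (by fun_prop :
      Continuous (Function.uncurry fun x ξ => f (x + ξ) - f x)).stronglyMeasurable
  exact ((by fun_prop : Measurable fun x => a * (θ - x) * deriv f x
    + σ ^ 2 * x / 2 * deriv (deriv f) x)).add h.measurable

section

variable {Ω : Type*} [mΩ : MeasurableSpace Ω] {a θ σ : ℝ} {ν : Measure ℝ} {x₀ : ℝ}
  {𝓕 : Filtration ℝ≥0 mΩ} {P : Measure Ω} {X : ℝ≥0 → Ω → ℝ}

lemma IsJCIRProcess.measurable (hX : IsJCIRProcess a θ σ ν x₀ 𝓕 P X) (t : ℝ≥0) :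
    Measurable (X t) :=
  (hX.adapted t).mono (𝓕.le t) le_rfl

lemma IsJCIRProcess.rightContinuous (hX : IsJCIRProcess a θ σ ν x₀ 𝓕 P X) :
    ∀ᵐ ω ∂P, ∀ t, ContinuousWithinAt (fun t => X t ω) (Ici t) t := by
  filter_upwards [hX.cadlag] with ω h t using (h t).1

lemma IsJCIRProcess.aemeasurable_uncurry [IsProbabilityMeasure P]
    (hX : IsJCIRProcess a θ σ ν x₀ 𝓕 P X) (μ : Measure ℝ) [SFinite μ] :
    AEMeasurable (fun p : ℝ × Ω => X p.1.toNNReal p.2) (μ.prod P) :=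
  aemeasurable_uncurry_of_rightContinuous hX.measurable hX.rightContinuous μ

lemma IsJCIRProcess.ae_prod_nonneg [IsProbabilityMeasure P]
    (hX : IsJCIRProcess a θ σ ν x₀ 𝓕 P X) (μ : Measure ℝ) [SFinite μ] :
    ∀ᵐ p : ℝ × Ω ∂(μ.prod P), 0 ≤ X p.1.toNNReal p.2 := by
  filter_upwards [Measure.quasiMeasurePreserving_snd.ae hX.nonneg] with p hp using hp _

lemma IsJCIRProcess.integrable_uncurry [IsProbabilityMeasure P]
    (hX : IsJCIRProcess a θ σ ν x₀ 𝓕 P X) (μ : Measure ℝ) [IsFiniteMeasure μ] {F : ℝ → ℝ} {C : ℝ}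
    (hF : Measurable F) (hC : ∀ x, 0 ≤ x → |F x| ≤ C) :
    Integrable (fun p : ℝ × Ω => F (X p.1.toNNReal p.2)) (μ.prod P) := by
  refine Integrable.of_bound
    (hF.comp_aemeasurable (hX.aemeasurable_uncurry μ)).aestronglyMeasurable C ?_
  filter_upwards [hX.ae_prod_nonneg μ] with p hp using hC _ hp

lemma IsJCIRProcess.integrable_comp [IsProbabilityMeasure P]
    (hX : IsJCIRProcess a θ σ ν x₀ 𝓕 P X) (t : ℝ≥0) {F : ℝ → ℝ} {C : ℝ}
    (hF : Measurable F) (hC : ∀ x, 0 ≤ x → |F x| ≤ C) :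
    Integrable (fun ω => F (X t ω)) P := by
  refine Integrable.of_bound (hF.comp (hX.measurable t)).aestronglyMeasurable C ?_
  filter_upwards [hX.nonneg] with ω h using hC _ (h t)

/-- Dynkin's formula for a smooth compactly supported function whose image under the generator is
bounded on `[0, ∞)`. -/
lemma IsJCIRProcess.dynkin_compactSupport [IsProbabilityMeasure P] [SFinite ν]
    (hX : IsJCIRProcess a θ σ ν x₀ 𝓕 P X) {f : ℝ → ℝ} (hf : ContDiff ℝ ((⊤ : ℕ∞) : WithTop ℕ∞) f)
    (hfs : HasCompactSupport f) {C : ℝ} (hC : ∀ x, 0 ≤ x → |jcirGenerator a θ σ ν f x| ≤ C)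
    (t : ℝ≥0) :
    ∫ ω, f (X t ω) ∂P = f x₀ + ∫ p, jcirGenerator a θ σ ν f (X p.1.toNNReal p.2)
      ∂((volume.restrict (Ioc (0 : ℝ) t)).prod P) := by
  have hM := hX.martingale f hf hfs
  obtain ⟨K, hK⟩ := hfs.exists_bound_of_continuous hf.continuous
  have hmart : ∫ ω, (f (X 0 ω) - ∫ s in (0 : ℝ)..((0 : ℝ≥0) : ℝ),
      jcirGenerator a θ σ ν f (X s.toNNReal ω)) ∂P
      = ∫ ω, (f (X t ω) - ∫ s in (0 : ℝ)..t, jcirGenerator a θ σ ν f (X s.toNNReal ω)) ∂P := by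
    have h := hM.setIntegral_eq (zero_le (a := t)) (s := univ) MeasurableSet.univ
    simpa only [Measure.restrict_univ] using h
  have hft : Integrable (fun ω => f (X t ω)) P :=
    hX.integrable_comp t hf.continuous.measurable fun x _ => hK x
  have hA := hX.integrable_uncurry (volume.restrict (Ioc (0 : ℝ) t))
    (measurable_jcirGenerator a θ σ ν hf.continuous) hC
  have h0 : ∫ ω, (f (X 0 ω) - ∫ s in (0 : ℝ)..((0 : ℝ≥0) : ℝ),
      jcirGenerator a θ σ ν f (X s.toNNReal ω)) ∂P = f x₀ := by
    simp only [NNReal.coe_zero, intervalIntegral.integral_same, sub_zero]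
    rw [integral_congr_ae (g := fun _ => f x₀)]
    · simp
    · filter_upwards [hX.start] with ω h
      rw [h]
  simp only [intervalIntegral.integral_of_le t.coe_nonneg] at hmart h0
  rw [h0, integral_sub hft hA.integral_prod_right, ← integral_prod_symm _ hA] at hmart
  linarith

/-- Dynkin's formula extends to functions that are limits, boundedly on `[0, ∞)` and together with
their images under the generator, of smooth compactly supported functions. -/
lemma IsJCIRProcess.dynkin_of_tendsto [IsProbabilityMeasure P] [SFinite ν]
    (hX : IsJCIRProcess a θ σ ν x₀ 𝓕 P X) (hx₀ : 0 ≤ x₀) {f : ℕ → ℝ → ℝ} {F G : ℝ → ℝ} {C : ℝ}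
    (hf : ∀ n, ContDiff ℝ ((⊤ : ℕ∞) : WithTop ℕ∞) (f n)) (hfs : ∀ n, HasCompactSupport (f n))
    (hfC : ∀ n x, 0 ≤ x → |f n x| ≤ C) (hAC : ∀ n x, 0 ≤ x → |jcirGenerator a θ σ ν (f n) x| ≤ C)
    (hF : ∀ x, 0 ≤ x → Tendsto (fun n => f n x) atTop (𝓝 (F x)))
    (hG : ∀ x, 0 ≤ x → Tendsto (fun n => jcirGenerator a θ σ ν (f n) x) atTop (𝓝 (G x)))
    (hGm : Measurable G) (t : ℝ≥0) :
    ∫ ω, F (X t ω) ∂P = F x₀ + ∫ s in (0 : ℝ)..t, ∫ ω, G (X s.toNNReal ω) ∂P := by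
  have hGC : ∀ x, 0 ≤ x → |G x| ≤ C := fun x hx =>
    le_of_tendsto (hG x hx).abs (Eventually.of_forall fun n => hAC n x hx)
  have hGi := hX.integrable_uncurry (volume.restrict (Ioc (0 : ℝ) t)) hGm hGC
  rw [intervalIntegral.integral_of_le t.coe_nonneg, ← integral_prod _ hGi]
  have hl : Tendsto (fun n => ∫ ω, f n (X t ω) ∂P) atTop (𝓝 (∫ ω, F (X t ω) ∂P)) := by
    refine tendsto_integral_of_dominated_convergence (fun _ => C)
      (fun n => ((hf n).continuous.measurable.comp (hX.measurable t)).aestronglyMeasurable)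
      (integrable_const C) (fun n => ?_) ?_
    · filter_upwards [hX.nonneg] with ω h using hfC n _ (h t)
    · filter_upwards [hX.nonneg] with ω h using hF _ (h t)
  have hr : Tendsto (fun n => f n x₀ + ∫ p, jcirGenerator a θ σ ν (f n) (X p.1.toNNReal p.2)
      ∂((volume.restrict (Ioc (0 : ℝ) t)).prod P)) atTop
      (𝓝 (F x₀ + ∫ p, G (X p.1.toNNReal p.2) ∂((volume.restrict (Ioc (0 : ℝ) t)).prod P))) := by
    refine (hF x₀ hx₀).add (tendsto_integral_of_dominated_convergence (fun _ => C)
      (fun n => ((measurable_jcirGenerator a θ σ ν (hf n).continuous).comp_aemeasurable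
        (hX.aemeasurable_uncurry _)).aestronglyMeasurable)
      (integrable_const C) (fun n => ?_) ?_)
    · filter_upwards [hX.ae_prod_nonneg (volume.restrict (Ioc (0 : ℝ) t))] with p h
        using hAC n _ h
    · filter_upwards [hX.ae_prod_nonneg (volume.restrict (Ioc (0 : ℝ) t))] with p h using hG _ h
  refine tendsto_nhds_unique hl (hr.congr fun n => ?_)
  exact (hX.dynkin_compactSupport (hf n) (hfs n) (hAC n) t).symm

end

/-! ### Dynkin's formula for exponential functions -/

lemma IsPositiveJumpLevyMeasure.integrable_min {ν : Measure ℝ} (hν : IsPositiveJumpLevyMeasure ν) :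
    Integrable (fun ξ : ℝ => min ξ 1) (ν.restrict (Ioi 0)) := by
  refine ⟨by fun_prop, ?_⟩
  rw [hasFiniteIntegral_iff_ofReal]
  · exact hν.finite_min
  · filter_upwards [ae_restrict_mem measurableSet_Ioi] with ξ hξ
    exact le_min (le_of_lt hξ) zero_le_one

/-- The Laplace exponent `κ(q) = ∫_{(0,∞)} (1 - e^{-qξ}) ν(dξ)` of the subordinator with Lévy
measure `ν`. -/
noncomputable def jumpLaplaceExponent (ν : Measure ℝ) (q : ℝ) : ℝ :=
  ∫ ξ in Ioi (0 : ℝ), (1 - Real.exp (-(q * ξ))) ∂ν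

/-- The branching mechanism `R(q) = a q + σ² q² / 2` of the continuous part. -/
noncomputable def jcirBranching (a σ q : ℝ) : ℝ := a * q + σ ^ 2 * q ^ 2 / 2

/-- The exponential `x ↦ e^{-qx}` cut off smoothly outside `[-1, n]`; the cutoff profile is
translated, not dilated, so its derivatives are bounded uniformly in `n`. -/
noncomputable def expCutoff (q : ℝ) (n : ℕ) (x : ℝ) : ℝ :=
  Real.exp (-(q * x)) * (Real.smoothTransition (x + 2) * Real.smoothTransition (n + 1 - x))

lemma contDiff_expCutoff (q : ℝ) (n : ℕ) : ContDiff ℝ ((⊤ : ℕ∞) : WithTop ℕ∞) (expCutoff q n) := by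
  have h : ContDiff ℝ ((⊤ : ℕ∞) : WithTop ℕ∞) Real.smoothTransition :=
    Real.smoothTransition.contDiff
  unfold expCutoff
  refine ContDiff.mul (by fun_prop) (ContDiff.mul ?_ ?_)
  · exact h.comp (by fun_prop)
  · exact h.comp (by fun_prop)

lemma hasCompactSupport_expCutoff (q : ℝ) (n : ℕ) : HasCompactSupport (expCutoff q n) := by
  refine HasCompactSupport.of_support_subset_isCompact (K := Icc (-2) (n + 1)) isCompact_Icc ?_
  intro x hx
  by_contra hx'
  refine hx ?_
  unfold expCutoff
  rcases lt_or_ge x (-2) with h | h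
  · rw [Real.smoothTransition.zero_of_nonpos (by linarith : x + 2 ≤ 0)]; simp
  · have : (n : ℝ) + 1 < x := by
      by_contra h2
      exact hx' ⟨h, not_lt.1 h2⟩
    rw [Real.smoothTransition.zero_of_nonpos (by linarith : (n : ℝ) + 1 - x ≤ 0)]; simp

lemma exists_bound_deriv_smoothTransition : ∃ K : ℝ, ∀ x,
    |deriv Real.smoothTransition x| ≤ K ∧ |deriv (deriv Real.smoothTransition) x| ≤ K := by
  have h : ContDiff ℝ ((⊤ : ℕ∞) : WithTop ℕ∞) Real.smoothTransition :=
    Real.smoothTransition.contDiff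
  have h1 : ContDiff ℝ ((⊤ : ℕ∞) : WithTop ℕ∞) (deriv Real.smoothTransition) :=
    (contDiff_infty_iff_deriv.1 h).2
  have h2 : ContDiff ℝ ((⊤ : ℕ∞) : WithTop ℕ∞) (deriv (deriv Real.smoothTransition)) :=
    (contDiff_infty_iff_deriv.1 h1).2
  have hs : HasCompactSupport (deriv Real.smoothTransition) := by
    refine HasCompactSupport.of_support_subset_isCompact (K := Icc 0 1) isCompact_Icc fun x hx => ?_
    by_contra hx'
    refine hx ?_
    rcases lt_or_ge x 0 with h | h
    · have : Real.smoothTransition =ᶠ[𝓝 x] fun _ => 0 := by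
        filter_upwards [Iio_mem_nhds h] with y hy
        exact Real.smoothTransition.zero_of_nonpos (le_of_lt hy)
      rw [this.deriv_eq, deriv_const]
    · have hx1 : 1 < x := by
        by_contra h2
        exact hx' ⟨h, not_lt.1 h2⟩
      have : Real.smoothTransition =ᶠ[𝓝 x] fun _ => 1 := by
        filter_upwards [Ioi_mem_nhds hx1] with y hy
        exact Real.smoothTransition.one_of_one_le (le_of_lt hy)
      rw [this.deriv_eq, deriv_const]
  obtain ⟨K₁, hK₁⟩ := hs.exists_bound_of_continuous h1.continuous
  obtain ⟨K₂, hK₂⟩ := hs.deriv.exists_bound_of_continuous h2.continuous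
  exact ⟨max K₁ K₂, fun x => ⟨(hK₁ x).trans (le_max_left _ _), (hK₂ x).trans (le_max_right _ _)⟩⟩

lemma expCutoff_eventuallyEq (q : ℝ) (n : ℕ) {x : ℝ} (hx : -1 < x) : expCutoff q n =ᶠ[𝓝 x]
    fun y => Real.exp (-(q * y)) * Real.smoothTransition (n + 1 - y) := by
  filter_upwards [Ioi_mem_nhds hx] with y hy
  have hy : -1 < y := hy
  rw [expCutoff, Real.smoothTransition.one_of_one_le (by linarith : 1 ≤ y + 2), one_mul]

lemma hasDerivAt_exp_neg_mul (q x : ℝ) :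
    HasDerivAt (fun y => Real.exp (-(q * y))) (Real.exp (-(q * x)) * -q) x := by
  simpa using ((hasDerivAt_id' x).const_mul q).fun_neg.exp

lemma deriv_expCutoff (q : ℝ) (n : ℕ) {x : ℝ} (hx : -1 < x) : deriv (expCutoff q n) x =
    Real.exp (-(q * x)) * (-q * Real.smoothTransition (n + 1 - x)
      - deriv Real.smoothTransition (n + 1 - x)) := by
  rw [(expCutoff_eventuallyEq q n hx).deriv_eq]
  have h : ContDiff ℝ ((⊤ : ℕ∞) : WithTop ℕ∞) Real.smoothTransition :=
    Real.smoothTransition.contDiff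
  have hd := ((h.differentiable (by simp)) ((n : ℝ) + 1 - x)).hasDerivAt
  have hc := hd.comp_const_sub ((n : ℝ) + 1) x
  rw [((hasDerivAt_exp_neg_mul q x).fun_mul hc).deriv]
  ring

lemma deriv_deriv_expCutoff (q : ℝ) (n : ℕ) {x : ℝ} (hx : -1 < x) :
    deriv (deriv (expCutoff q n)) x =
    Real.exp (-(q * x)) * (q ^ 2 * Real.smoothTransition (n + 1 - x)
      + 2 * q * deriv Real.smoothTransition (n + 1 - x)
      + deriv (deriv Real.smoothTransition) (n + 1 - x)) := by
  have heq : deriv (expCutoff q n) =ᶠ[𝓝 x] fun x =>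
    Real.exp (-(q * x)) * (-q * Real.smoothTransition (n + 1 - x)
      - deriv Real.smoothTransition (n + 1 - x)) := by
    filter_upwards [Ioi_mem_nhds hx] with y hy using deriv_expCutoff q n hy
  rw [heq.deriv_eq]
  have h : ContDiff ℝ ((⊤ : ℕ∞) : WithTop ℕ∞) Real.smoothTransition :=
    Real.smoothTransition.contDiff
  have h1 : ContDiff ℝ ((⊤ : ℕ∞) : WithTop ℕ∞) (deriv Real.smoothTransition) :=
    (contDiff_infty_iff_deriv.1 h).2
  have hc := ((h.differentiable (by simp)) ((n : ℝ) + 1 - x)).hasDerivAt.comp_const_sub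
    ((n : ℝ) + 1) x
  have hc1 := ((h1.differentiable (by simp)) ((n : ℝ) + 1 - x)).hasDerivAt.comp_const_sub
    ((n : ℝ) + 1) x
  rw [((hasDerivAt_exp_neg_mul q x).fun_mul ((hc.const_mul (-q)).fun_sub hc1)).deriv]
  ring

lemma expCutoff_mem_Icc {q : ℝ} (hq : 0 < q) (n : ℕ) {x : ℝ} (hx : 0 ≤ x) :
    expCutoff q n x ∈ Icc 0 1 := by
  have h1 := Real.smoothTransition.nonneg (x + 2)
  have h2 := Real.smoothTransition.nonneg (n + 1 - x)
  refine ⟨by unfold expCutoff; positivity, ?_⟩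
  have h3 : Real.exp (-(q * x)) ≤ 1 := Real.exp_le_one_iff.2 (by nlinarith)
  exact mul_le_one₀ h3 (by positivity)
    (mul_le_one₀ (Real.smoothTransition.le_one _) h2 (Real.smoothTransition.le_one _))

lemma mul_exp_neg_mul_le {q : ℝ} (hq : 0 < q) (x : ℝ) : x * Real.exp (-(q * x)) ≤ 1 / q := by
  have h := Real.add_one_le_exp (q * x)
  rw [Real.exp_neg, le_div_iff₀ hq, ← div_eq_mul_inv, div_mul_eq_mul_div,
    div_le_one (Real.exp_pos _)]
  linarith

lemma abs_expCutoff_add_sub_le {q K : ℝ} (hq : 0 < q)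
    (hK : ∀ x, |deriv Real.smoothTransition x| ≤ K) (n : ℕ) {x ξ : ℝ} (hx : 0 ≤ x) (hξ : 0 < ξ) :
    |expCutoff q n (x + ξ) - expCutoff q n x| ≤ (q + K + 1) * min ξ 1 := by
  have hK0 : 0 ≤ K := (abs_nonneg _).trans (hK 0)
  rcases le_or_gt 1 ξ with h | h
  · rw [min_eq_right h, mul_one, abs_le]
    have h1 := expCutoff_mem_Icc hq n hx
    have h2 := expCutoff_mem_Icc hq n (x := x + ξ) (by positivity)
    constructor <;> linarith [h1.1, h1.2, h2.1, h2.2]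
  · rw [min_eq_left h.le]
    have hb : ∀ y ∈ Ici (0 : ℝ), ‖deriv (expCutoff q n) y‖ ≤ q + K := fun y hy => by
      have hy : 0 ≤ y := hy
      rw [deriv_expCutoff q n (by linarith), norm_mul, Real.norm_of_nonneg (Real.exp_pos _).le]
      have h3 : Real.exp (-(q * y)) ≤ 1 := Real.exp_le_one_iff.2 (by nlinarith)
      have h4 : ‖-q * Real.smoothTransition (n + 1 - y)
          - deriv Real.smoothTransition (n + 1 - y)‖ ≤ q + K := by
        refine (norm_sub_le _ _).trans (add_le_add ?_ (hK _))
        rw [norm_mul, norm_neg, Real.norm_of_nonneg hq.le,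
          Real.norm_of_nonneg (Real.smoothTransition.nonneg _)]
        exact mul_le_of_le_one_right hq.le (Real.smoothTransition.le_one _)
      calc _ ≤ 1 * (q + K) := mul_le_mul h3 h4 (norm_nonneg _) zero_le_one
        _ = q + K := one_mul _
    have h := (convex_Ici (0 : ℝ)).norm_image_sub_le_of_norm_deriv_le (f := expCutoff q n)
      (fun y _ => ((contDiff_expCutoff q n).differentiable (by simp)) y) hb
      (mem_Ici.2 hx) (mem_Ici.2 (by positivity : 0 ≤ x + ξ))
    rw [add_sub_cancel_left, Real.norm_of_nonneg hξ.le] at h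
    exact h.trans (by nlinarith)

/-- On `[0, ∞)` the generator maps the cut off exponentials to functions bounded uniformly in `n`:
the factors `x` of the drift and of the diffusion are absorbed by `e^{-qx}`. -/
lemma exists_bound_jcirGenerator_expCutoff {a σ q : ℝ} (ha : 0 < a) (hq : 0 < q)
    {ν : Measure ℝ} (hν : IsPositiveJumpLevyMeasure ν) :
    ∃ C : ℝ, ∀ n x, 0 ≤ x → |jcirGenerator a 0 σ ν (expCutoff q n) x| ≤ C := by
  obtain ⟨K, hK⟩ := exists_bound_deriv_smoothTransition
  have hK0 : 0 ≤ K := (abs_nonneg _).trans (hK 0).1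
  refine ⟨a * (1 / q * (q + K)) + σ ^ 2 / 2 * (1 / q * (q ^ 2 + 2 * q * K + K))
    + ∫ ξ in Ioi (0 : ℝ), (q + K + 1) * min ξ 1 ∂ν, fun n x hx => ?_⟩
  have hx1 : -1 < x := by linarith
  have hθ0 := Real.smoothTransition.nonneg (n + 1 - x)
  have hθ1 := Real.smoothTransition.le_one (n + 1 - x)
  have hxe : |x * Real.exp (-(q * x))| ≤ 1 / q := by
    rw [abs_of_nonneg (by positivity)]
    exact mul_exp_neg_mul_le hq x
  have hqθ : |q * Real.smoothTransition (n + 1 - x)| ≤ q := by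
    rw [abs_of_nonneg (by positivity)]
    exact mul_le_of_le_one_right hq.le hθ1
  have h1 : |a * (0 - x) * deriv (expCutoff q n) x| ≤ a * (1 / q * (q + K)) := by
    rw [deriv_expCutoff q n hx1, show a * (0 - x) * (Real.exp (-(q * x)) *
      (-q * Real.smoothTransition (n + 1 - x) - deriv Real.smoothTransition (n + 1 - x)))
      = a * ((x * Real.exp (-(q * x))) *
      (q * Real.smoothTransition (n + 1 - x) + deriv Real.smoothTransition (n + 1 - x))) by ring,
      abs_mul, abs_of_pos ha, abs_mul]
    gcongr
    exact (abs_add_le _ _).trans (add_le_add hqθ (hK _).1)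
  have h2 : |σ ^ 2 * x / 2 * deriv (deriv (expCutoff q n)) x|
      ≤ σ ^ 2 / 2 * (1 / q * (q ^ 2 + 2 * q * K + K)) := by
    rw [deriv_deriv_expCutoff q n hx1, show σ ^ 2 * x / 2 * (Real.exp (-(q * x)) *
      (q ^ 2 * Real.smoothTransition (n + 1 - x) + 2 * q * deriv Real.smoothTransition (n + 1 - x)
        + deriv (deriv Real.smoothTransition) (n + 1 - x)))
      = σ ^ 2 / 2 * ((x * Real.exp (-(q * x))) *
      (q * (q * Real.smoothTransition (n + 1 - x))
        + 2 * q * deriv Real.smoothTransition (n + 1 - x)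
        + deriv (deriv Real.smoothTransition) (n + 1 - x))) by ring,
      abs_mul, abs_of_nonneg (by positivity : 0 ≤ σ ^ 2 / 2), abs_mul]
    gcongr
    refine (abs_add_three _ _ _).trans (add_le_add (add_le_add ?_ ?_) (hK _).2)
    · rw [abs_mul, abs_of_pos hq, sq]
      gcongr
    · rw [abs_mul, abs_of_pos (by positivity : 0 < 2 * q)]
      have := (hK (n + 1 - x)).1
      gcongr
  have h3 : |∫ ξ in Ioi (0 : ℝ), (expCutoff q n (x + ξ) - expCutoff q n x) ∂ν|
      ≤ ∫ ξ in Ioi (0 : ℝ), (q + K + 1) * min ξ 1 ∂ν := by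
    rw [← Real.norm_eq_abs]
    refine norm_integral_le_of_norm_le (hν.integrable_min.const_mul _) ?_
    filter_upwards [ae_restrict_mem measurableSet_Ioi] with ξ hξ
    exact abs_expCutoff_add_sub_le hq (fun y => (hK y).1) n hx hξ
  exact (abs_add_three _ _ _).trans (add_le_add (add_le_add h1 h2) h3)

lemma expCutoff_eventually_eq (q x : ℝ) (hx : 0 ≤ x) :
    ∀ᶠ n : ℕ in atTop, expCutoff q n x = Real.exp (-(q * x)) := by
  filter_upwards [tendsto_natCast_atTop_atTop.eventually_ge_atTop x] with n hn
  rw [expCutoff, Real.smoothTransition.one_of_one_le (by linarith : 1 ≤ x + 2),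
    Real.smoothTransition.one_of_one_le (by linarith : 1 ≤ (n : ℝ) + 1 - x), one_mul, mul_one]

lemma tendsto_jcirGenerator_expCutoff {a σ q : ℝ} (hq : 0 < q)
    {ν : Measure ℝ} (hν : IsPositiveJumpLevyMeasure ν) {x : ℝ} (hx : 0 ≤ x) :
    Tendsto (fun n => jcirGenerator a 0 σ ν (expCutoff q n) x) atTop
      (𝓝 (Real.exp (-(q * x)) * (x * jcirBranching a σ q - jumpLaplaceExponent ν q))) := by
  obtain ⟨K, hK⟩ := exists_bound_deriv_smoothTransition
  have hjump : Tendsto (fun n : ℕ => ∫ ξ in Ioi (0 : ℝ),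
      (expCutoff q n (x + ξ) - expCutoff q n x) ∂ν) atTop
      (𝓝 (∫ ξ in Ioi (0 : ℝ), (Real.exp (-(q * (x + ξ))) - Real.exp (-(q * x))) ∂ν)) := by
    refine tendsto_integral_of_dominated_convergence (fun ξ => (q + K + 1) * min ξ 1)
      (fun n => ?_) (hν.integrable_min.const_mul _) (fun n => ?_) ?_
    · have := (contDiff_expCutoff q n).continuous
      exact (by fun_prop : Continuous fun ξ => expCutoff q n (x + ξ)
        - expCutoff q n x).aestronglyMeasurable
    · filter_upwards [ae_restrict_mem measurableSet_Ioi] with ξ hξ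
      exact abs_expCutoff_add_sub_le hq (fun y => (hK y).1) n hx hξ
    · filter_upwards [ae_restrict_mem measurableSet_Ioi] with ξ hξ
      have hξ : 0 < ξ := hξ
      exact (tendsto_const_nhds.congr' ((expCutoff_eventually_eq q (x + ξ) (by positivity)).mono
        fun n h => h.symm)).sub
        (tendsto_const_nhds.congr' ((expCutoff_eventually_eq q x hx).mono fun n h => h.symm))
  have hval : ∫ ξ in Ioi (0 : ℝ), (Real.exp (-(q * (x + ξ))) - Real.exp (-(q * x))) ∂ν
      = -(Real.exp (-(q * x)) * jumpLaplaceExponent ν q) := by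
    rw [jumpLaplaceExponent, ← integral_const_mul, ← integral_neg]
    refine integral_congr_ae (ae_of_all _ fun ξ => ?_)
    simp only
    rw [mul_add, neg_add, Real.exp_add]
    ring
  rw [hval] at hjump
  have hlocal : Tendsto (fun n : ℕ => a * (0 - x) * deriv (expCutoff q n) x
      + σ ^ 2 * x / 2 * deriv (deriv (expCutoff q n)) x) atTop
      (𝓝 (Real.exp (-(q * x)) * (x * jcirBranching a σ q))) := by
    refine tendsto_const_nhds.congr' ?_
    filter_upwards [tendsto_natCast_atTop_atTop.eventually_gt_atTop x] with n hn
    have hx1 : -1 < x := by linarith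
    have h1 : Real.smoothTransition =ᶠ[𝓝 ((n : ℝ) + 1 - x)] fun _ => 1 := by
      filter_upwards [Ioi_mem_nhds (by linarith : 1 < (n : ℝ) + 1 - x)] with y hy
      exact Real.smoothTransition.one_of_one_le (le_of_lt hy)
    have h2 : deriv Real.smoothTransition ((n : ℝ) + 1 - x) = 0 := by
      rw [h1.deriv_eq, deriv_const]
    have h3 : deriv (deriv Real.smoothTransition) ((n : ℝ) + 1 - x) = 0 := by
      rw [h1.deriv.deriv_eq]; simp
    rw [deriv_expCutoff q n hx1, deriv_deriv_expCutoff q n hx1, h2, h3, h1.eq_of_nhds,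
      jcirBranching]
    ring
  have h := hlocal.add hjump
  rw [← sub_eq_add_neg, ← mul_sub] at h
  exact h

section

variable {Ω : Type*} [mΩ : MeasurableSpace Ω] {a σ : ℝ} {ν : Measure ℝ}
  {𝓕 : Filtration ℝ≥0 mΩ} {P : Measure Ω} {Z : ℝ≥0 → Ω → ℝ}

/-- The integrated forward equation for the Laplace transform. -/
lemma IsJCIRProcess.integral_exp_neg_mul [IsProbabilityMeasure P]
    (hZ : IsJCIRProcess a 0 σ ν 0 𝓕 P Z) (ha : 0 < a) (hν : IsPositiveJumpLevyMeasure ν) {q : ℝ}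
    (hq : 0 < q) (t : ℝ≥0) :
    ∫ ω, Real.exp (-(q * Z t ω)) ∂P = 1 + ∫ s in (0 : ℝ)..t, ∫ ω, Real.exp (-(q * Z s.toNNReal ω)) *
        (Z s.toNNReal ω * jcirBranching a σ q - jumpLaplaceExponent ν q) ∂P := by
  have := hν.sFinite
  obtain ⟨C, hC⟩ := exists_bound_jcirGenerator_expCutoff (σ := σ) ha hq hν
  have h := hZ.dynkin_of_tendsto le_rfl (f := expCutoff q) (F := fun x => Real.exp (-(q * x)))
    (G := fun x => Real.exp (-(q * x)) * (x * jcirBranching a σ q - jumpLaplaceExponent ν q))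
    (C := max 1 C) (contDiff_expCutoff q) (hasCompactSupport_expCutoff q)
    (fun n x hx => by
      obtain ⟨h0, h1⟩ := expCutoff_mem_Icc hq n hx
      rw [abs_of_nonneg h0]
      exact h1.trans (le_max_left _ _))
    (fun n x hx => (hC n x hx).trans (le_max_right _ _))
    (fun x hx => tendsto_const_nhds.congr'
      ((expCutoff_eventually_eq q x hx).mono fun n h => h.symm))
    (fun x hx => tendsto_jcirGenerator_expCutoff hq hν hx) (by fun_prop) t
  simpa using h

end

/-! ### The Laplace transform along characteristics -/

lemma one_sub_exp_neg_mul_le {q ξ : ℝ} (hq : 0 < q) (hξ : 0 < ξ) :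
    0 ≤ 1 - Real.exp (-(q * ξ)) ∧ 1 - Real.exp (-(q * ξ)) ≤ (q + 1) * min ξ 1 := by
  have h1 : Real.exp (-(q * ξ)) ≤ 1 :=
    Real.exp_le_one_iff.2 (by have := mul_pos hq hξ; linarith)
  have h2 := Real.add_one_le_exp (-(q * ξ))
  have h3 := Real.exp_pos (-(q * ξ))
  refine ⟨by linarith, ?_⟩
  rcases min_cases ξ 1 with ⟨h, _⟩ | ⟨h, _⟩ <;> rw [h] <;> nlinarith

lemma jumpLaplaceExponent_nonneg (ν : Measure ℝ) {q : ℝ} (hq : 0 < q) :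
    0 ≤ jumpLaplaceExponent ν q :=
  setIntegral_nonneg measurableSet_Ioi fun _ hξ => (one_sub_exp_neg_mul_le hq hξ).1

lemma integrable_one_sub_exp_neg_mul {ν : Measure ℝ} (hν : IsPositiveJumpLevyMeasure ν) {q : ℝ}
    (hq : 0 < q) : Integrable (fun ξ => 1 - Real.exp (-(q * ξ))) (ν.restrict (Ioi 0)) := by
  refine (hν.integrable_min.const_mul (q + 1)).mono' (by fun_prop) ?_
  filter_upwards [ae_restrict_mem measurableSet_Ioi] with ξ hξ
  rw [Real.norm_of_nonneg (one_sub_exp_neg_mul_le hq hξ).1]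
  exact (one_sub_exp_neg_mul_le hq hξ).2

lemma continuousAt_jumpLaplaceExponent {ν : Measure ℝ} (hν : IsPositiveJumpLevyMeasure ν) {q : ℝ}
    (hq : 0 < q) : ContinuousAt (jumpLaplaceExponent ν) q := by
  refine continuousAt_of_dominated (bound := fun ξ => (2 * q + 1) * min ξ 1)
    (Eventually.of_forall fun q' => by fun_prop) ?_ (hν.integrable_min.const_mul _)
    (ae_of_all _ fun ξ => by fun_prop)
  filter_upwards [Ioo_mem_nhds hq (by linarith : q < 2 * q)] with q' hq'
  filter_upwards [ae_restrict_mem measurableSet_Ioi] with ξ hξ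
  have hξ : 0 < ξ := hξ
  rw [Real.norm_of_nonneg (one_sub_exp_neg_mul_le hq'.1 hξ).1]
  refine (one_sub_exp_neg_mul_le hq'.1 hξ).2.trans ?_
  have : 0 < min ξ 1 := lt_min hξ one_pos
  have := hq'.2
  gcongr

lemma measurable_jumpLaplaceExponent (ν : Measure ℝ) [SFinite ν] :
    Measurable (jumpLaplaceExponent ν) :=
  (StronglyMeasurable.integral_prod_right (f := fun q ξ => 1 - Real.exp (-(q * ξ)))
    (by fun_prop : Continuous (Function.uncurry fun q ξ : ℝ =>
      1 - Real.exp (-(q * ξ)))).stronglyMeasurable).measurable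

lemma abs_exp_neg_mul_mul_le {a σ q z : ℝ} (ha : 0 < a) (hq : 0 < q) (hz : 0 ≤ z)
    (ν : Measure ℝ) :
    |Real.exp (-(q * z)) * (z * jcirBranching a σ q - jumpLaplaceExponent ν q)|
      ≤ 1 / q * jcirBranching a σ q + jumpLaplaceExponent ν q := by
  have hR : 0 ≤ jcirBranching a σ q := by unfold jcirBranching; positivity
  have hκ := jumpLaplaceExponent_nonneg ν hq
  have he : Real.exp (-(q * z)) ≤ 1 := Real.exp_le_one_iff.2 (by nlinarith)
  have he0 := Real.exp_pos (-(q * z))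
  have hze := mul_exp_neg_mul_le hq z
  have h1 : Real.exp (-(q * z)) * (z * jcirBranching a σ q) ≤ 1 / q * jcirBranching a σ q := by
    rw [← mul_assoc, mul_comm (Real.exp _)]
    gcongr
  have h2 : Real.exp (-(q * z)) * jumpLaplaceExponent ν q ≤ jumpLaplaceExponent ν q :=
    mul_le_of_le_one_left hκ he
  have h3 : 0 ≤ Real.exp (-(q * z)) * (z * jcirBranching a σ q) := by positivity
  have h4 : 0 ≤ Real.exp (-(q * z)) * jumpLaplaceExponent ν q := by positivity
  rw [mul_sub, abs_le]
  constructor <;> linarith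

lemma continuousAt_generator_bound {a σ q : ℝ} {ν : Measure ℝ}
    (hν : IsPositiveJumpLevyMeasure ν) (hq : 0 < q) :
    ContinuousAt (fun q => 1 / q * jcirBranching a σ q + jumpLaplaceExponent ν q) q := by
  have h1 : ContinuousAt (fun q : ℝ => 1 / q) q := by fun_prop (disch := exact hq.ne')
  have h2 : Continuous (jcirBranching a σ) := by unfold jcirBranching; fun_prop
  exact (h1.mul h2.continuousAt).add (continuousAt_jumpLaplaceExponent hν hq)

section

variable {Ω : Type*} [mΩ : MeasurableSpace Ω] {a σ : ℝ} {ν : Measure ℝ}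
  {𝓕 : Filtration ℝ≥0 mΩ} {P : Measure Ω} {Z : ℝ≥0 → Ω → ℝ}

/-- The expectation of the generator applied to `x ↦ e^{-qx}` at time `s`. -/
noncomputable def expGeneratorMean (a σ : ℝ) (ν : Measure ℝ) (P : Measure Ω) (Z : ℝ≥0 → Ω → ℝ)
    (s q : ℝ) : ℝ :=
  ∫ ω, Real.exp (-(q * Z s.toNNReal ω)) *
    (Z s.toNNReal ω * jcirBranching a σ q - jumpLaplaceExponent ν q) ∂P

lemma IsJCIRProcess.intervalIntegrable_expGeneratorMean [IsProbabilityMeasure P]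
    (hZ : IsJCIRProcess a 0 σ ν 0 𝓕 P Z) (ha : 0 < a) {q : ℝ}
    (hq : 0 < q) (s s' : ℝ) :
    IntervalIntegrable (fun r => expGeneratorMean a σ ν P Z r q) volume s s' := by
  rw [intervalIntegrable_iff, IntegrableOn, uIoc]
  exact (hZ.integrable_uncurry (volume.restrict (Ioc (min s s') (max s s')))
    (F := fun z => Real.exp (-(q * z)) * (z * jcirBranching a σ q - jumpLaplaceExponent ν q))
    (by fun_prop) fun z hz => abs_exp_neg_mul_mul_le ha hq hz ν).integral_prod_left

lemma IsJCIRProcess.integral_exp_neg_mul_sub [IsProbabilityMeasure P]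
    (hZ : IsJCIRProcess a 0 σ ν 0 𝓕 P Z) (ha : 0 < a) (hν : IsPositiveJumpLevyMeasure ν) {q : ℝ}
    (hq : 0 < q) {s s' : ℝ} (hs : 0 ≤ s) (hs' : 0 ≤ s') :
    ∫ ω, Real.exp (-(q * Z s'.toNNReal ω)) ∂P - ∫ ω, Real.exp (-(q * Z s.toNNReal ω)) ∂P
      = ∫ r in s..s', expGeneratorMean a σ ν P Z r q := by
  rw [hZ.integral_exp_neg_mul ha hν hq, hZ.integral_exp_neg_mul ha hν hq, Real.coe_toNNReal _ hs,
    Real.coe_toNNReal _ hs', add_sub_add_left_eq_sub]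
  exact intervalIntegral.integral_interval_sub_left
    (hZ.intervalIntegrable_expGeneratorMean ha hq 0 s')
    (hZ.intervalIntegrable_expGeneratorMean ha hq 0 s)

lemma IsJCIRProcess.abs_expGeneratorMean_le [IsProbabilityMeasure P]
    (hZ : IsJCIRProcess a 0 σ ν 0 𝓕 P Z) (ha : 0 < a) {q : ℝ} (hq : 0 < q) (s : ℝ) :
    |expGeneratorMean a σ ν P Z s q| ≤ 1 / q * jcirBranching a σ q + jumpLaplaceExponent ν q := by
  have h := norm_integral_le_of_norm_le_const (μ := P)
    (f := fun ω => Real.exp (-(q * Z s.toNNReal ω)) *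
      (Z s.toNNReal ω * jcirBranching a σ q - jumpLaplaceExponent ν q))
    (C := 1 / q * jcirBranching a σ q + jumpLaplaceExponent ν q) (by
      filter_upwards [hZ.nonneg] with ω h
      exact abs_exp_neg_mul_mul_le ha hq (h _) ν)
  simpa [expGeneratorMean] using h

/-- Right-continuity of the paths gives continuity of the averaged generator in `(s, q)`, from the
right in `s`. -/
lemma IsJCIRProcess.continuousWithinAt_expGeneratorMean [IsProbabilityMeasure P]
    (hZ : IsJCIRProcess a 0 σ ν 0 𝓕 P Z) (ha : 0 < a) (hν : IsPositiveJumpLevyMeasure ν) {s q : ℝ}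
    (hq : 0 < q) :
    ContinuousWithinAt (fun p : ℝ × ℝ => expGeneratorMean a σ ν P Z p.1 p.2)
      (Ici s ×ˢ univ) (s, q) := by
  have hR : Continuous (jcirBranching a σ) := by unfold jcirBranching; fun_prop
  have hsnd : Tendsto Prod.snd (𝓝[Ici s ×ˢ univ] (s, q)) (𝓝 q) :=
    (continuous_snd.tendsto' (s, q) q rfl).mono_left nhdsWithin_le_nhds
  refine continuousWithinAt_of_dominated
    (bound := fun _ => 1 / q * jcirBranching a σ q + jumpLaplaceExponent ν q + 1)
    (Eventually.of_forall fun p => ?_) ?_ (integrable_const _) ?_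
  · have := hZ.measurable p.1.toNNReal
    exact (by fun_prop : Measurable fun ω => Real.exp (-(p.2 * Z p.1.toNNReal ω)) *
      (Z p.1.toNNReal ω * jcirBranching a σ p.2 - jumpLaplaceExponent ν p.2)).aestronglyMeasurable
  · have h1 := hsnd.eventually ((continuousAt_generator_bound (a := a) (σ := σ) hν hq).eventually_lt
      continuousAt_const (lt_add_one _))
    have h2 := hsnd.eventually (Ioi_mem_nhds hq)
    filter_upwards [h1, h2] with p hp1 hp2
    filter_upwards [hZ.nonneg] with ω h
    exact (abs_exp_neg_mul_mul_le ha hp2 (h _) ν).trans hp1.le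
  · filter_upwards [hZ.rightContinuous] with ω h
    have hZc : ContinuousWithinAt (fun p : ℝ × ℝ => Z p.1.toNNReal ω) (Ici s ×ˢ univ) (s, q) := by
      refine ContinuousWithinAt.comp (x := (s, q)) (t := Ici s.toNNReal)
        (f := fun p : ℝ × ℝ => p.1.toNNReal) (h s.toNNReal)
        (continuous_real_toNNReal.comp continuous_fst).continuousWithinAt fun p hp => ?_
      exact Real.toNNReal_le_toNNReal hp.1
    have hκ : ContinuousWithinAt (fun p : ℝ × ℝ => jumpLaplaceExponent ν p.2)
        (Ici s ×ˢ univ) (s, q) :=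
      ((continuousAt_jumpLaplaceExponent hν hq).comp (x := (s, q)) (f := Prod.snd)
        continuousAt_snd).continuousWithinAt
    have hs : ContinuousWithinAt (fun p : ℝ × ℝ => p.2) (Ici s ×ˢ univ) (s, q) :=
      continuousWithinAt_snd
    exact (hs.mul hZc).neg.rexp.mul ((hZc.mul (hR.continuousAt.comp_continuousWithinAt hs)).sub hκ)

lemma IsJCIRProcess.hasDerivAt_integral_exp_neg_mul [IsProbabilityMeasure P]
    (hZ : IsJCIRProcess a 0 σ ν 0 𝓕 P Z) (s : ℝ≥0) {q : ℝ} (hq : 0 < q) :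
    HasDerivAt (fun q => ∫ ω, Real.exp (-(q * Z s ω)) ∂P)
      (-∫ ω, Real.exp (-(q * Z s ω)) * Z s ω ∂P) q := by
  have hm := hZ.measurable s
  have h := hasDerivAt_integral_of_dominated_loc_of_deriv_le (μ := P)
    (F := fun q ω => Real.exp (-(q * Z s ω))) (F' := fun q ω => -(Real.exp (-(q * Z s ω)) * Z s ω))
    (bound := fun _ => 1 / (q / 2)) (x₀ := q) (s := Ioi (q / 2)) (Ioi_mem_nhds (by linarith))
    (Eventually.of_forall fun q' => by fun_prop) ?_ (by fun_prop) ?_ (integrable_const _) ?_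
  · rw [integral_neg] at h
    exact h.2
  · exact hZ.integrable_comp s (F := fun z => Real.exp (-(q * z))) (C := 1) (by fun_prop)
      fun z hz => by
        rw [abs_of_pos (Real.exp_pos _), Real.exp_le_one_iff]
        nlinarith
  · filter_upwards [hZ.nonneg] with ω h q' hq'
    have hq' : q / 2 < q' := hq'
    have hq0 : 0 < q' := by linarith
    have := h s
    rw [norm_neg, Real.norm_of_nonneg (by positivity), mul_comm]
    exact (mul_exp_neg_mul_le hq0 _).trans (one_div_le_one_div_of_le (by linarith) hq'.le)
  · refine ae_of_all _ fun ω q' _ => ?_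
    simpa using ((hasDerivAt_id' q').mul_const (Z s ω)).fun_neg.exp

lemma IsJCIRProcess.continuousWithinAt_laplace_characteristic [IsProbabilityMeasure P]
    (hZ : IsJCIRProcess a 0 σ ν 0 𝓕 P Z) (ha : 0 < a) (hν : IsPositiveJumpLevyMeasure ν) {q : ℝ → ℝ}
    {s : ℝ} (hs : 0 ≤ s) (hq : 0 < q s) (hqc : ContinuousAt q s) :
    ContinuousWithinAt (fun r => ∫ ω, Real.exp (-(q r * Z r.toNNReal ω)) ∂P) (Ici 0) s := by
  have hqc' : Tendsto q (𝓝[Ici 0] s) (𝓝 (q s)) := hqc.tendsto.mono_left nhdsWithin_le_nhds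
  have h2 : Tendsto (fun r => ∫ ω, Real.exp (-(q r * Z s.toNNReal ω)) ∂P) (𝓝[Ici 0] s)
      (𝓝 (∫ ω, Real.exp (-(q s * Z s.toNNReal ω)) ∂P)) :=
    (hZ.hasDerivAt_integral_exp_neg_mul s.toNNReal hq).continuousAt.tendsto.comp hqc'
  have h1 : Tendsto (fun r => ∫ ω, Real.exp (-(q r * Z r.toNNReal ω)) ∂P
      - ∫ ω, Real.exp (-(q r * Z s.toNNReal ω)) ∂P) (𝓝[Ici 0] s) (𝓝 0) := by
    have hb : Tendsto (fun r => (1 / q r * jcirBranching a σ (q r) + jumpLaplaceExponent ν (q r))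
        * |r - s|) (𝓝[Ici 0] s) (𝓝 ((1 / q s * jcirBranching a σ (q s)
          + jumpLaplaceExponent ν (q s)) * |s - s|)) := by
      refine ((continuousAt_generator_bound hν hq).tendsto.comp hqc').mul ?_
      exact ((by fun_prop : Continuous fun r : ℝ => |r - s|).tendsto s).mono_left
        nhdsWithin_le_nhds
    rw [sub_self, abs_zero, mul_zero] at hb
    refine squeeze_zero_norm' ?_ hb
    filter_upwards [hqc'.eventually (Ioi_mem_nhds hq), self_mem_nhdsWithin] with r hr hr0
    rw [hZ.integral_exp_neg_mul_sub ha hν hr hs hr0]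
    exact intervalIntegral.norm_integral_le_of_norm_le_const fun x _ =>
      hZ.abs_expGeneratorMean_le ha hr x
  have h := h1.add h2
  simpa [ContinuousWithinAt] using h

/-- Along a characteristic `q' = R(q)` the first-order term of the forward equation cancels, and
only the jump term `-κ(q)` is left. -/
lemma IsJCIRProcess.hasDerivWithinAt_laplace_characteristic [IsProbabilityMeasure P]
    (hZ : IsJCIRProcess a 0 σ ν 0 𝓕 P Z) (ha : 0 < a) (hν : IsPositiveJumpLevyMeasure ν) {q : ℝ → ℝ}
    {s : ℝ} (hs : 0 ≤ s) (hq : 0 < q s) (hqd : HasDerivAt q (jcirBranching a σ (q s)) s) :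
    HasDerivWithinAt (fun r => ∫ ω, Real.exp (-(q r * Z r.toNNReal ω)) ∂P)
      (-jumpLaplaceExponent ν (q s) * ∫ ω, Real.exp (-(q s * Z s.toNNReal ω)) ∂P) (Ici s) s := by
  have h2 : HasDerivAt (fun r => ∫ ω, Real.exp (-(q r * Z s.toNNReal ω)) ∂P)
      ((-∫ ω, Real.exp (-(q s * Z s.toNNReal ω)) * Z s.toNNReal ω ∂P)
        * jcirBranching a σ (q s)) s :=
    (hZ.hasDerivAt_integral_exp_neg_mul s.toNNReal hq).comp s hqd
  -- The increment in time with `q` frozen at the moving endpoint `q r` is a time integral of the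
  -- averaged generator, which is continuous from the right at `(s, q s)`.
  have h1 : HasDerivWithinAt (fun r => ∫ ω, Real.exp (-(q r * Z r.toNNReal ω)) ∂P
      - ∫ ω, Real.exp (-(q r * Z s.toNNReal ω)) ∂P) (expGeneratorMean a σ ν P Z s (q s))
      (Ici s) s := by
    rw [hasDerivWithinAt_iff_isLittleO, Asymptotics.isLittleO_iff]
    intro ε hε
    obtain ⟨δ, hδ, hcont⟩ := Metric.continuousWithinAt_iff.1
      (hZ.continuousWithinAt_expGeneratorMean ha hν (s := s) hq) ε hε
    filter_upwards [self_mem_nhdsWithin, nhdsWithin_le_nhds (Metric.ball_mem_nhds s hδ),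
      nhdsWithin_le_nhds (hqd.continuousAt (Metric.ball_mem_nhds (q s) hδ)),
      nhdsWithin_le_nhds (hqd.continuousAt (Ioi_mem_nhds hq))] with s' hs' hs'δ hqδ hq'
    have hs' : s ≤ s' := hs'
    have hq' : 0 < q s' := hq'
    have hii := hZ.intervalIntegrable_expGeneratorMean ha hq' s s'
    rw [sub_self, sub_zero, hZ.integral_exp_neg_mul_sub ha hν hq' hs (hs.trans hs'),
      ← intervalIntegral.integral_const, ← intervalIntegral.integral_sub hii (by simp)]
    refine intervalIntegral.norm_integral_le_of_norm_le_const fun r hr => ?_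
    rw [uIoc_of_le hs'] at hr
    rw [Metric.mem_ball, Real.dist_eq] at hs'δ
    refine (hcont (x := (r, q s')) ⟨hr.1.le, mem_univ _⟩ ?_).le
    rw [Prod.dist_eq]
    refine max_lt ?_ hqδ
    rw [abs_of_nonneg (by linarith)] at hs'δ
    change dist r s < δ
    rw [Real.dist_eq, abs_of_nonneg (by linarith [hr.1])]
    linarith [hr.2]
  have hval : expGeneratorMean a σ ν P Z s (q s)
      + (-∫ ω, Real.exp (-(q s * Z s.toNNReal ω)) * Z s.toNNReal ω ∂P) * jcirBranching a σ (q s)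
      = -jumpLaplaceExponent ν (q s) * ∫ ω, Real.exp (-(q s * Z s.toNNReal ω)) ∂P := by
    have hi1 : Integrable (fun ω => Real.exp (-(q s * Z s.toNNReal ω)) * Z s.toNNReal ω) P :=
      hZ.integrable_comp _ (F := fun z => Real.exp (-(q s * z)) * z) (C := 1 / q s) (by fun_prop)
        fun z hz => by
          rw [abs_of_nonneg (by positivity), mul_comm]
          exact mul_exp_neg_mul_le hq z
    have hi2 : Integrable (fun ω => Real.exp (-(q s * Z s.toNNReal ω))) P :=
      hZ.integrable_comp _ (F := fun z => Real.exp (-(q s * z))) (C := 1) (by fun_prop)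
        fun z hz => by
          rw [abs_of_pos (Real.exp_pos _), Real.exp_le_one_iff]
          nlinarith
    have : expGeneratorMean a σ ν P Z s (q s)
        = (∫ ω, Real.exp (-(q s * Z s.toNNReal ω)) * Z s.toNNReal ω ∂P) * jcirBranching a σ (q s)
          - (∫ ω, Real.exp (-(q s * Z s.toNNReal ω)) ∂P) * jumpLaplaceExponent ν (q s) := by
      rw [← integral_mul_const, ← integral_mul_const,
        ← integral_sub (hi1.mul_const _) (hi2.mul_const _), expGeneratorMean]
      refine integral_congr_ae (ae_of_all _ fun ω => ?_)
      simp only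
      ring
    rw [this]
    ring
  rw [← hval]
  refine (h1.add h2.hasDerivWithinAt).congr (fun r _ => ?_) ?_ <;> simp

/-- Solving the scalar linear equation along a characteristic. -/
lemma IsJCIRProcess.laplace_eq_of_characteristic [IsProbabilityMeasure P]
    (hZ : IsJCIRProcess a 0 σ ν 0 𝓕 P Z) (ha : 0 < a) (hν : IsPositiveJumpLevyMeasure ν) {q : ℝ → ℝ}
    {t : ℝ} (ht : 0 ≤ t) (hqm : Measurable q) (hq : ∀ s ∈ Icc 0 t, 0 < q s)
    (hqd : ∀ s ∈ Icc 0 t, HasDerivAt q (jcirBranching a σ (q s)) s) :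
    ∫ ω, Real.exp (-(q t * Z t.toNNReal ω)) ∂P
      = Real.exp (-∫ s in (0 : ℝ)..t, jumpLaplaceExponent ν (q s)) := by
  have := hν.sFinite
  set g : ℝ → ℝ := fun r => ∫ ω, Real.exp (-(q r * Z r.toNNReal ω)) ∂P with hg
  set I : ℝ → ℝ := fun r => ∫ s in (0 : ℝ)..r, jumpLaplaceExponent ν (q s) with hI
  have hκc : ∀ s ∈ Icc 0 t, ContinuousAt (fun s => jumpLaplaceExponent ν (q s)) s := fun s hs =>
    (continuousAt_jumpLaplaceExponent hν (hq s hs)).comp (hqd s hs).continuousAt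
  have hκm : StronglyMeasurable fun s => jumpLaplaceExponent ν (q s) :=
    ((measurable_jumpLaplaceExponent ν).comp hqm).stronglyMeasurable
  have hId : ∀ s ∈ Icc 0 t, HasDerivAt I (jumpLaplaceExponent ν (q s)) s := fun s hs => by
    refine intervalIntegral.integral_hasDerivAt_right (ContinuousOn.intervalIntegrable ?_)
      hκm.stronglyMeasurableAtFilter (hκc s hs)
    rw [uIcc_of_le hs.1]
    exact fun r hr => (hκc r ⟨hr.1, hr.2.trans hs.2⟩).continuousWithinAt
  have hconst := constant_of_has_deriv_right_zero (f := fun s => g s * Real.exp (I s))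
    (a := 0) (b := t) (fun s hs => ?_) (fun s hs => ?_) t (right_mem_Icc.2 ht)
  · have hI0 : I 0 = 0 := by simp [hI]
    have hg0 : g 0 = 1 := by
      rw [hg]
      simp only [Real.toNNReal_zero]
      rw [integral_congr_ae (g := fun _ => (1 : ℝ))]
      · simp
      · filter_upwards [hZ.start] with ω h
        simp [h]
    simp only [hI0, hg0, Real.exp_zero, mul_one] at hconst
    rw [Real.exp_neg]
    exact eq_inv_of_mul_eq_one_left hconst
  · refine ContinuousWithinAt.mul ?_ (hId s hs).continuousAt.rexp.continuousWithinAt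
    exact (hZ.continuousWithinAt_laplace_characteristic ha hν hs.1 (hq s hs)
      (hqd s hs).continuousAt).mono Icc_subset_Ici_self
  · have hs' := Ico_subset_Icc_self hs
    refine ((hZ.hasDerivWithinAt_laplace_characteristic ha hν hs.1 (hq s hs') (hqd s hs')).mul
      (hId s hs').exp.hasDerivWithinAt).congr_deriv ?_
    ring

/-! ### The atom at zero -/

/-- The characteristic through `l`, run backwards in time: `s ↦ -ψ(s, -l)` in real terms. -/
noncomputable def jcirCharacteristic (a σ l s : ℝ) : ℝ :=
  l * Real.exp (-(a * s)) / (1 + σ ^ 2 / (2 * a) * l * (1 - Real.exp (-(a * s))))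

lemma jcirCharacteristic_den_pos {a σ l s : ℝ} (ha : 0 < a) (hl : 0 < l) (hs : 0 ≤ s) :
    0 < 1 + σ ^ 2 / (2 * a) * l * (1 - Real.exp (-(a * s))) := by
  have : Real.exp (-(a * s)) ≤ 1 := Real.exp_le_one_iff.2 (by nlinarith)
  have : 0 ≤ 1 - Real.exp (-(a * s)) := by linarith
  positivity

lemma jcirCharacteristic_pos {a σ l s : ℝ} (ha : 0 < a) (hl : 0 < l) (hs : 0 ≤ s) :
    0 < jcirCharacteristic a σ l s := by
  have := jcirCharacteristic_den_pos (σ := σ) ha hl hs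
  unfold jcirCharacteristic
  positivity

lemma hasDerivAt_jcirCharacteristic {a σ l s : ℝ} (ha : 0 < a) (hl : 0 < l) (hs : 0 ≤ s) :
    HasDerivAt (jcirCharacteristic a σ l)
      (-jcirBranching a σ (jcirCharacteristic a σ l s)) s := by
  have hD := (jcirCharacteristic_den_pos (σ := σ) ha hl hs).ne'
  have he := hasDerivAt_exp_neg_mul a s
  refine ((he.const_mul l).fun_div (((he.const_sub 1).const_mul (σ ^ 2 / (2 * a) * l)).const_add 1)
    hD).congr_deriv ?_
  unfold jcirBranching jcirCharacteristic
  generalize Real.exp (-(a * s)) = E at hD ⊢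
  have hD2 : 2 * a + σ ^ 2 * l * (1 - E) ≠ 0 := fun h => hD (by field_simp; linarith)
  field_simp
  ring

lemma jcirCharacteristic_mul_le_jcirAlpha {a σ l s ξ : ℝ} (ha : 0 < a) (hσ : 0 < σ) (hl : 0 < l)
    (hs : 0 < s) (hξ : 0 < ξ) : jcirCharacteristic a σ l s * ξ ≤ jcirAlpha a σ s ξ := by
  have hD := jcirCharacteristic_den_pos (σ := σ) ha hl hs.le
  have hE := exp_mul_sub_one_pos ha hs
  have hE0 := Real.exp_pos (a * s)
  unfold jcirCharacteristic jcirAlpha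
  rw [div_mul_eq_mul_div, div_le_div_iff₀ hD (by positivity)]
  rw [Real.exp_neg] at hD ⊢
  generalize Real.exp (a * s) = E at hE hE0 hD ⊢
  have h1 : l * E⁻¹ * ξ * (σ ^ 2 * (E - 1)) = l * ξ * σ ^ 2 * (1 - E⁻¹) := by field_simp
  have h2 : 2 * a * ξ * (1 + σ ^ 2 / (2 * a) * l * (1 - E⁻¹))
      = 2 * a * ξ + l * ξ * σ ^ 2 * (1 - E⁻¹) := by field_simp
  rw [h1, h2]
  have : 0 < 2 * a * ξ := by positivity
  linarith

lemma integral_jumpLaplaceExponent_characteristic_le {a σ l t : ℝ} (ha : 0 < a) (hσ : 0 < σ)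
    (hl : 0 < l) (ht : 0 < t) {ν : Measure ℝ} (hν : IsPositiveJumpLevyMeasure ν)
    (hfin : ∫⁻ s in Ioc (0 : ℝ) t, ∫⁻ ξ in Ioi (0 : ℝ),
        ENNReal.ofReal (1 - Real.exp (-jcirAlpha a σ s ξ)) ∂ν < ∞) :
    ∫ s in (0 : ℝ)..t, jumpLaplaceExponent ν (jcirCharacteristic a σ l s)
      ≤ (∫⁻ s in Ioc (0 : ℝ) t, ∫⁻ ξ in Ioi (0 : ℝ),
        ENNReal.ofReal (1 - Real.exp (-jcirAlpha a σ s ξ)) ∂ν).toReal := by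
  have := hν.sFinite
  have hqm : Measurable (jcirCharacteristic a σ l) := by unfold jcirCharacteristic; fun_prop
  rw [intervalIntegral.integral_of_le ht.le, integral_eq_lintegral_of_nonneg_ae]
  · refine ENNReal.toReal_mono hfin.ne (setLIntegral_mono' measurableSet_Ioc fun s hs => ?_)
    have hq := jcirCharacteristic_pos (σ := σ) ha hl hs.1.le
    rw [jumpLaplaceExponent, ofReal_integral_eq_lintegral_ofReal
      (integrable_one_sub_exp_neg_mul hν hq)]
    · refine setLIntegral_mono' measurableSet_Ioi fun ξ hξ => ENNReal.ofReal_le_ofReal ?_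
      have := jcirCharacteristic_mul_le_jcirAlpha ha hσ hl hs.1 hξ
      gcongr
    · filter_upwards [ae_restrict_mem measurableSet_Ioi] with ξ hξ
      exact (one_sub_exp_neg_mul_le hq hξ).1
  · filter_upwards [ae_restrict_mem measurableSet_Ioc] with s hs
    exact jumpLaplaceExponent_nonneg ν (jcirCharacteristic_pos ha hl hs.1.le)
  · exact ((measurable_jumpLaplaceExponent ν).comp hqm).aestronglyMeasurable

/-- The Laplace transform of `Z t` at any `l > 0` is bounded below by `e^{-λ}`, where `λ` is the
total jump intensity. -/
lemma IsJCIRProcess.exp_neg_le_laplace [IsProbabilityMeasure P]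
    (hZ : IsJCIRProcess a 0 σ ν 0 𝓕 P Z) (ha : 0 < a) (hσ : 0 < σ)
    (hν : IsPositiveJumpLevyMeasure ν) {t : ℝ≥0} (ht : 0 < t)
    (hfin : ∫⁻ s in Ioc (0 : ℝ) t, ∫⁻ ξ in Ioi (0 : ℝ),
        ENNReal.ofReal (1 - Real.exp (-jcirAlpha a σ s ξ)) ∂ν < ∞) {l : ℝ} (hl : 0 < l) :
    Real.exp (-(∫⁻ s in Ioc (0 : ℝ) t, ∫⁻ ξ in Ioi (0 : ℝ),
        ENNReal.ofReal (1 - Real.exp (-jcirAlpha a σ s ξ)) ∂ν).toReal)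
      ≤ ∫ ω, Real.exp (-(l * Z t ω)) ∂P := by
  have hqm : Measurable (jcirCharacteristic a σ l) := by unfold jcirCharacteristic; fun_prop
  have h := hZ.laplace_eq_of_characteristic ha hν (q := fun s => jcirCharacteristic a σ l (t - s))
    t.coe_nonneg (by fun_prop) (fun s hs => jcirCharacteristic_pos ha hl (by linarith [hs.2]))
    fun s hs => by
      have := (hasDerivAt_jcirCharacteristic (σ := σ) ha hl
        (by linarith [hs.2] : 0 ≤ (t : ℝ) - s)).comp_const_sub (t : ℝ) s
      simpa using this
  have hend : jcirCharacteristic a σ l 0 = l := by simp [jcirCharacteristic]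
  rw [intervalIntegral.integral_comp_sub_left
    (fun s => jumpLaplaceExponent ν (jcirCharacteristic a σ l s)), sub_self, sub_zero] at h
  simp only [hend, Real.toNNReal_coe] at h
  rw [h]
  exact Real.exp_le_exp.2 (neg_le_neg
    (integral_jumpLaplaceExponent_characteristic_le ha hσ hl (by exact_mod_cast ht) hν hfin))

/-- Letting `l → ∞` in the lower bound for the Laplace transform, which then converges to the mass
of the atom at `0`. -/
theorem IsJCIRProcess.measure_eq_zero_pos [IsProbabilityMeasure P]
    (hZ : IsJCIRProcess a 0 σ ν 0 𝓕 P Z) (ha : 0 < a) (hσ : 0 < σ)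
    (hν : IsPositiveJumpLevyMeasure ν)
    (hlog : ∫⁻ ξ in Ioo (0 : ℝ) 1, ENNReal.ofReal (ξ * Real.log (1 / ξ)) ∂ν < ∞) {t : ℝ≥0}
    (ht : 0 < t) : 0 < P {ω | Z t ω = 0} := by
  have hfin := lintegral_jump_intensity_lt_top ha hσ (t := t) (by exact_mod_cast ht) hν hlog
  have hm := hZ.measurable t
  have hset : MeasurableSet {ω | Z t ω = 0} := hm (measurableSet_singleton 0)
  have hlim : Tendsto (fun n : ℕ => ∫ ω, Real.exp (-(((n : ℝ) + 1) * Z t ω)) ∂P) atTop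
      (𝓝 (∫ ω, {ω | Z t ω = 0}.indicator 1 ω ∂P)) := by
    refine tendsto_integral_of_dominated_convergence (fun _ => (1 : ℝ))
      (fun n => by fun_prop) (integrable_const _) (fun n => ?_) ?_
    · filter_upwards [hZ.nonneg] with ω h
      have := h t
      rw [Real.norm_of_nonneg (Real.exp_pos _).le, Real.exp_le_one_iff]
      have : 0 ≤ ((n : ℝ) + 1) * Z t ω := by positivity
      linarith
    · filter_upwards [hZ.nonneg] with ω h
      rcases (h t).eq_or_lt with h0 | h0
      · simp [← h0]
      · rw [indicator_of_notMem (by simpa using h0.ne')]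
        refine Real.tendsto_exp_neg_atTop_nhds_zero.comp ?_
        exact (tendsto_atTop_add_const_right _ 1 tendsto_natCast_atTop_atTop).atTop_mul_const h0
  rw [integral_indicator_one hset] at hlim
  have hle := ge_of_tendsto' hlim fun n => hZ.exp_neg_le_laplace ha hσ hν ht hfin
    (by positivity : (0 : ℝ) < (n : ℝ) + 1)
  have hpos : 0 < P.real {ω | Z t ω = 0} := (Real.exp_pos _).trans_le hle
  exact (ENNReal.toReal_pos_iff.1 hpos).1

end

theorem mainTheorem4 (a σ : ℝ) (ha : 0 < a) (hσ : 0 < σ) (ν : Measure ℝ)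
    (hν : IsPositiveJumpLevyMeasure ν)
    (hlog : ∫⁻ ξ in Ioo (0 : ℝ) 1, ENNReal.ofReal (ξ * Real.log (1 / ξ)) ∂ν < ∞) :
    (∀ t : ℝ, 0 < t → ∃ (r : ℝ≥0) (ρ : Measure ℝ),
      IsProbabilityMeasure ρ ∧ ρ (Iic 0) = 0 ∧ (ν ≠ 0 → 0 < r) ∧
      (r : ℝ≥0∞) = ∫⁻ s in Ioc (0 : ℝ) t, ∫⁻ ξ in Ioi (0 : ℝ),
        ENNReal.ofReal (1 - Real.exp (-jcirAlpha a σ s ξ)) ∂ν ∧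
      (∀ B : Set ℝ, MeasurableSet B →
        (r : ℝ≥0∞) * ρ B = ∫⁻ s in Ioc (0 : ℝ) t, ∫⁻ ξ in Ioi (0 : ℝ),
          besselDistribution (jcirAlpha a σ s ξ) (jcirBeta a σ s) (B ∩ Ioi 0) ∂ν) ∧
      (∀ u : ℂ, u.re ≤ 0 →
        ∫ x : ℝ, Complex.exp (u * (x : ℂ)) ∂(compoundPoisson r ρ) = jcirFactorII a σ ν t u)) ∧
    (∀ (Ω : Type*) [mΩ : MeasurableSpace Ω] (P : Measure Ω) [IsProbabilityMeasure P]
      (𝓕 : Filtration ℝ≥0 mΩ) (Z : ℝ≥0 → Ω → ℝ),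
      IsJCIRProcess a 0 σ ν 0 𝓕 P Z → ∀ t : ℝ≥0, 0 < t → 0 < P {ω | Z t ω = 0}) :=
  ⟨fun _ ht => exists_compoundPoisson_jcirFactorII ha hσ hν hlog ht,
    fun _ _ _ _ _ _ hZ _ ht => hZ.measure_eq_zero_pos ha hσ hν hlog ht⟩
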